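/- Let $n\ge 1$ and $m>0$. Write points of position space $\mathbb R^{1+n}$ as $\tilde x=(x^+,\tilde{\mathbf x})$ with $\tilde{\mathbf x}=(x_\perp,x^-)\in\mathbb R^{n-1}\times\mathbb R$, and points of momentum space as $\tilde p=(\tilde{\mathbf p},p^-)$ with $\tilde{\mathbf p}=(p^+,p_\perp)\in\mathbb R\times\mathbb R^{n-1}$. Put $\langle\tilde x,\tilde p\rangle=x^+p^-+x^-p^+-x_\perp\cdot p_\perp$ and $\tilde p^2=2p^+p^--p_\perp^2$. Let $(\mathcal F_{\mathbb L}f)(\tilde p)=\int f(\tilde x)e^{i\langle\tilde x,\tilde p\rangle}\,d\tilde x$ and $(\mathcal F_{LC}f)(\tilde{\mathbf p})=\int f(\tilde{\mathbf x})e^{i(x^-p^+-x_\perp\cdot p_\perp)}\,d\tilde{\mathbf x}$, extended to generalized functions by duality. Let $\mathcal S_{p^+}(\mathbb R^n)$ be the space of $f\in C^\infty(\mathbb R^n,\mathbb C)$ with $\sup_{p^+\ne0}|(p^+)^kp_\perp^\beta\partial^\alpha f|<\infty$ for all $k\in\mathbb Z$ and all multi-indices $\alpha,\beta$, topologized by these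 seminorms, and let $\mathcal S'_{p^+}(\mathbb R^n)$ be its dual. A function on $\{p^+\neq 0\}$ is regarded as an element of $\mathcal S_{p^+}(\mathbb R^n)$ if its extension by zero belongs to that space. If $M$ is a function on $\{p^+\ne0\}$ such that $Mf\in\mathcal S_{p^+}(\mathbb R^n)$ for all $f\in\mathcal S_{p^+}(\mathbb R^n)$, then $Mb$ is defined by $(Mb,f)=(b,Mf)$. Let $\mathcal S_{\partial_-}(\mathbb R^{k})=\bigcap_{r\ge0}\partial_{x^-}^r\mathcal S(\mathbb R^{k})$ ($k=n$ or $k=1+n$), with the topology induced by $\mathcal S(\mathbb R^k)$, and let $\mathcal S'_{\partial_-}(\mathbb R^k)$ be its dual. The relaxation $u^*\in\mathcal S'_{\partial_-}(\mathbb R^{1+n})$ of $u\in\mathcal S'(\mathbb R^{1+n})$ is the restriction of $u$ to $\mathcal S_{\partial_-}(\mathbb R^{1+n})$. For $\Omega\subset\mathbb R$ open, $v\in\mathcal S'_{\partial_-}(\mathbb R^{1+n})$ is called $C^\infty$-dependent on $x^+\in\Omega$ as a parameter if there is a family $(v_{x^+})_{x^+\in\Omega}$ in $\mathcal S'_{\partial_-}(\mathbb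 R^n)$ such that $x^+\mapsto(v_{x^+},g)$ is $C^\infty$ on $\Omega$ and $(v,f\otimes g)=\int_\Omega(v_{x^+},g)f(x^+)\,dx^+$ for all $f\in\mathcal D(\Omega)$ and $g\in\mathcal S_{\partial_-}(\mathbb R^n)$. A distribution $u\in\mathcal S'(\mathbb R^{1+n})$ admits a tame restriction to $\{x^+=0\}$ if $u^*$ is $C^\infty$-dependent on $x^+\in\Omega$ as a parameter for some open neighbourhood $\Omega$ of $0$. Put $\tilde\omega(\tilde{\mathbf p})=(p_\perp^2+m^2)/(2p^+)$ for $p^+\neq 0$. (i) For every $b\in\mathcal S'_{p^+}(\mathbb R^n)$ the formula $(b(\tilde{\mathbf p})\delta(\tilde p^2-m^2),f)=\bigl(b(\tilde{\mathbf p}),\tfrac{1}{2|p^+|}f(\tilde{\mathbf p},\tilde\omega(\tilde{\mathbf p}))\bigr)$, $f\in\mathcal S(\mathbb R^{1+n})$, defines a (unique) tempered distribution. Let $u=\mathcal F_{\mathbb L}^{-1}\bigl(b(\tilde{\mathbf p})\delta(\tilde p^2-m^2)\bigr)\in\mathcal S'(\mathbb R^{1+n})$. Then $u^*$ is $C^\infty$-dependent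 on $x^+\in\mathbb R$ as a parameter, and the (uniquely determined) corresponding family is given for all $x^+\in\mathbb R$ by $$u^*_{x^+}=\frac1{4\pi}\,\mathcal F_{LC}^{-1}\left(\frac{e^{-i\tilde\omega(\tilde{\mathbf p})x^+}}{|p^+|}\,b(\tilde{\mathbf p})\right)\in\mathcal S'_{\partial_-}(\mathbb R^n),$$ where $\frac{e^{-i\tilde\omega x^+}}{|p^+|}b\in\mathcal S'_{p^+}(\mathbb R^n)$ and its image under $\mathcal F_{LC}^{-1}$ are well defined. (ii) Every $u\in\mathcal S'(\mathbb R^{1+n})$ that satisfies $(2\partial_+\partial_--\sum_{i=1}^{n-1}\partial_i^2+m^2)u=0$ admits a tame restriction to $\{x^+=0\}$. -/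

import Mathlib

open scoped SchwartzMap LineDeriv ContDiff FourierTransform Distributions
open TopologicalSpace MeasureTheory

noncomputable section

namespace LightCone

/-- `ℝ^k` with its Euclidean structure. Throughout `d = n - 1` is the number of transverse
dimensions, so that `ℝ^n` is `Space (d + 1)` and `ℝ^{1+n}` is `Space (d + 2)`.

Coordinates: a point of `ℝ^{1+n}` in position space is `x = (x⁺, x_⊥, x⁻)` and in momentum space
`p = (p⁺, p_⊥, p⁻)`. A spatial point is `(x_⊥, x⁻) ∈ ℝ^n` and a spatial momentum is
`(p⁺, p_⊥) ∈ ℝ^n`. -/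
abbrev Space (k : ℕ) : Type := EuclideanSpace ℝ (Fin k)

/-- The spatial part `(x_⊥, x⁻)` of `x = (x⁺, x_⊥, x⁻)`. -/
def spatial {d : ℕ} (x : Space (d + 2)) : Space (d + 1) :=
  WithLp.toLp 2 fun i => x i.succ

/-- The transverse part `p_⊥` of a spatial momentum `(p⁺, p_⊥)`. -/
def perp {d : ℕ} (p : Space (d + 1)) : Space d :=
  WithLp.toLp 2 fun i => p i.succ

/-! ### Light-cone Fourier transforms -/

/-- The light-cone bilinear form `x⁺p⁻ + x⁻p⁺ - x_⊥·p_⊥` on `ℝ^{1+n}`. -/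
def lcForm {d : ℕ} (x p : Space (d + 2)) : ℝ :=
  x 0 * p (Fin.last (d + 1)) + x (Fin.last (d + 1)) * p 0
    - ∑ i : Fin d, x i.succ.castSucc * p i.succ.castSucc

/-- The spatial form `x⁻p⁺ - x_⊥·p_⊥` of `(x_⊥, x⁻)` and `(p⁺, p_⊥)`. -/
def lcSpatialForm {d : ℕ} (x p : Space (d + 1)) : ℝ :=
  x (Fin.last d) * p 0 - ∑ i : Fin d, x i.castSucc * p i.succ

/-- The map `(p⁺, p_⊥, p⁻) ↦ (p⁻, -p_⊥, p⁺)`, which represents `lcForm` with respect to the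
Euclidean inner product. -/
def lcFlip (d : ℕ) : Space (d + 2) ≃L[ℝ] Space (d + 2) :=
  LinearEquiv.toContinuousLinearEquiv
    { toFun := fun p => WithLp.toLp 2
        (Fin.cons (p (Fin.last (d + 1))) (Fin.snoc (fun i : Fin d => -p i.succ.castSucc) (p 0)))
      invFun := fun p => WithLp.toLp 2
        (Fin.cons (p (Fin.last (d + 1))) (Fin.snoc (fun i : Fin d => -p i.succ.castSucc) (p 0)))
      map_add' := by
        intro p q
        ext i
        refine Fin.cases ?_ (fun j => ?_) i
        · simp
        · refine Fin.lastCases ?_ (fun l => ?_) j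
          · simp
          · simp; ring
      map_smul' := by
        intro c p
        ext i
        refine Fin.cases ?_ (fun j => ?_) i
        · simp
        · refine Fin.lastCases ?_ (fun l => ?_) j
          · simp
          · simp
      left_inv := by
        intro p
        ext i
        refine Fin.cases ?_ (fun j => ?_) i
        · simp [← Fin.succ_last]
        · refine Fin.lastCases ?_ (fun l => ?_) j
          · simp
          · simp
      right_inv := by
        intro p
        ext i
        refine Fin.cases ?_ (fun j => ?_) i
        · simp [← Fin.succ_last]
        · refine Fin.lastCases ?_ (fun l => ?_) j
          · simp
          · simp }

/-- The map `(x_⊥, x⁻) ↦ (x⁻, -x_⊥)`, which represents `lcSpatialForm`. -/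
def lcSpatialFlip (d : ℕ) : Space (d + 1) ≃L[ℝ] Space (d + 1) :=
  LinearEquiv.toContinuousLinearEquiv
    { toFun := fun x => WithLp.toLp 2
        (Fin.cons (x (Fin.last d)) (fun i : Fin d => -x i.castSucc))
      invFun := fun p => WithLp.toLp 2
        (Fin.snoc (fun i : Fin d => -p i.succ) (p 0))
      map_add' := by
        intro p q
        ext i
        refine Fin.cases ?_ (fun j => ?_) i
        · simp
        · simp; ring
      map_smul' := by
        intro c p
        ext i
        refine Fin.cases ?_ (fun j => ?_) i
        · simp
        · simp
      left_inv := by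
        intro p
        ext i
        refine Fin.lastCases ?_ (fun j => ?_) i
        · simp
        · simp
      right_inv := by
        intro p
        ext i
        refine Fin.cases ?_ (fun j => ?_) i
        · simp
        · simp }

/-- For a linear automorphism `K` of `ℝ^k`, the Fourier transform
`f ↦ (p ↦ ∫ f(x) exp(i ⟪x, K p⟫) dx)` as an automorphism of the Schwartz space
(see `fourierVia_apply`). -/
def fourierVia {k : ℕ} (K : Space k ≃L[ℝ] Space k) : 𝓢(Space k, ℂ) ≃L[ℂ] 𝓢(Space k, ℂ) :=
  let A : Space k ≃L[ℝ] Space k :=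
    K.trans (ContinuousLinearEquiv.smulLeft
      (Units.mk0 (-(2 * Real.pi)⁻¹ : ℝ) (by simp [Real.pi_ne_zero])))
  (FourierTransform.fourierCLE ℂ 𝓢(Space k, ℂ)).trans
    (ContinuousLinearEquiv.equivOfInverse
      (SchwartzMap.compCLMOfContinuousLinearEquiv ℂ A)
      (SchwartzMap.compCLMOfContinuousLinearEquiv ℂ A.symm)
      (fun f => by ext x; simp) (fun f => by ext x; simp))

theorem fourierVia_apply {k : ℕ} (K : Space k ≃L[ℝ] Space k) (f : 𝓢(Space k, ℂ)) (p : Space k) :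
    fourierVia K f p = ∫ x, f x * Complex.exp (Complex.I * (inner ℝ x (K p) : ℝ)) := by
  have h : fourierVia K f p = 𝓕 (f : Space k → ℂ) ((-(2 * Real.pi)⁻¹ : ℝ) • K p) := rfl
  rw [h, Real.fourier_eq']
  refine integral_congr_ae (Filter.Eventually.of_forall fun x => ?_)
  simp only [smul_eq_mul, inner_smul_right]
  rw [mul_comm]
  congr 2
  push_cast
  have : (Real.pi : ℂ) ≠ 0 := by exact_mod_cast Real.pi_ne_zero
  field_simp

/-- The Fourier transform `𝓕_L f(p) = ∫ f(x) exp(i⟨x,p⟩_L) dx` on `𝓢(ℝ^{1+n})`. -/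
def lcFourier (d : ℕ) : 𝓢(Space (d + 2), ℂ) ≃L[ℂ] 𝓢(Space (d + 2), ℂ) :=
  fourierVia (lcFlip d)

theorem lcFourier_apply {d : ℕ} (f : 𝓢(Space (d + 2), ℂ)) (p : Space (d + 2)) :
    lcFourier d f p = ∫ x, f x * Complex.exp (Complex.I * lcForm x p) := by
  rw [lcFourier, fourierVia_apply]
  congr 1; ext x; congr 4
  rw [PiLp.inner_apply, Fin.sum_univ_succ, Fin.sum_univ_castSucc]
  simp [lcFlip, lcForm, mul_comm]
  ring

/-- The spatial light-cone Fourier transform of a function `h(p⁺, p_⊥)` of the momentum variables,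
`x ↦ ∫ h(p) exp(i(x⁻p⁺ - x_⊥·p_⊥)) dp`. It is the transpose of the transform
`(𝓕_LC f)(p) = ∫ f(x) exp(i(x⁻p⁺ - x_⊥·p_⊥)) dx` of functions of `(x_⊥, x⁻)`. -/
def lcSpatialFourier (d : ℕ) : 𝓢(Space (d + 1), ℂ) ≃L[ℂ] 𝓢(Space (d + 1), ℂ) :=
  fourierVia (lcSpatialFlip d)

theorem lcSpatialFourier_apply {d : ℕ} (h : 𝓢(Space (d + 1), ℂ)) (x : Space (d + 1)) :
    lcSpatialFourier d h x = ∫ p, h p * Complex.exp (Complex.I * lcSpatialForm x p) := by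
  rw [lcSpatialFourier, fourierVia_apply]
  congr 1; ext p; congr 4
  rw [PiLp.inner_apply, Fin.sum_univ_succ]
  simp [lcSpatialFlip, lcSpatialForm]
  ring

/-- `𝓕_L⁻¹` on tempered distributions: `(𝓕_L⁻¹ v, f) = (v, 𝓕_L⁻¹ f)` (the form is symmetric). -/
def lcFourierInv {d : ℕ} (v : 𝓢'(Space (d + 2), ℂ)) : 𝓢'(Space (d + 2), ℂ) :=
  PointwiseConvergenceCLM.precomp ℂ
    ((lcFourier d).symm : 𝓢(Space (d + 2), ℂ) →L[ℂ] 𝓢(Space (d + 2), ℂ)) v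

theorem lcFourierInv_apply {d : ℕ} (v : 𝓢'(Space (d + 2), ℂ)) (f : 𝓢(Space (d + 2), ℂ)) :
    lcFourierInv v f = v ((lcFourier d).symm f) := rfl

/-! ### Squeezed functions and squeezed generalized functions -/

/-- The smooth functions `f` on `ℝ^n` with
`sup_{p⁺ ≠ 0} |p⁺|^k ‖p_⊥‖^l ‖D^j f(p)‖ < ∞` for all `k ∈ ℤ` and `l, j ∈ ℕ`. -/
def squeezedSubmodule (d : ℕ) : Submodule ℂ (Space (d + 1) → ℂ) where
  carrier := {f | ContDiff ℝ ∞ f ∧ ∀ (k : ℤ) (l j : ℕ), ∃ C : ℝ, ∀ p : Space (d + 1), p 0 ≠ 0 →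
    |p 0| ^ k * ‖perp p‖ ^ l * ‖iteratedFDeriv ℝ j f p‖ ≤ C}
  zero_mem' := by
    refine ⟨contDiff_const, fun k l j => ⟨0, fun p _ => ?_⟩⟩
    have : iteratedFDeriv ℝ j (0 : Space (d + 1) → ℂ) p = 0 := by
      rw [iteratedFDeriv_zero]; rfl
    simp [this]
  add_mem' := by
    rintro f g ⟨hf, hf'⟩ ⟨hg, hg'⟩
    refine ⟨hf.add hg, fun k l j => ?_⟩
    obtain ⟨C, hC⟩ := hf' k l j
    obtain ⟨D, hD⟩ := hg' k l j
    refine ⟨C + D, fun p hp => ?_⟩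
    rw [iteratedFDeriv_add_apply (hf.contDiffAt.of_le (by exact_mod_cast le_top))
      (hg.contDiffAt.of_le (by exact_mod_cast le_top))]
    calc _ ≤ |p 0| ^ k * ‖perp p‖ ^ l * (‖iteratedFDeriv ℝ j f p‖ + ‖iteratedFDeriv ℝ j g p‖) := by
          gcongr; exact norm_add_le _ _
      _ ≤ C + D := by rw [mul_add]; exact add_le_add (hC p hp) (hD p hp)
  smul_mem' := by
    rintro c f ⟨hf, hf'⟩
    refine ⟨contDiff_const.smul hf, fun k l j => ?_⟩
    obtain ⟨C, hC⟩ := hf' k l j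
    refine ⟨‖c‖ * C, fun p hp => ?_⟩
    rw [iteratedFDeriv_const_smul_apply (hf.contDiffAt.of_le (by exact_mod_cast le_top)),
      norm_smul]
    calc _ = ‖c‖ * (|p 0| ^ k * ‖perp p‖ ^ l * ‖iteratedFDeriv ℝ j f p‖) := by ring
      _ ≤ ‖c‖ * C := by gcongr; exact hC p hp

/-- The squeezed Schwartz space `𝓢_{p⁺}(ℝ^n)`. -/
def SqueezedSchwartz (d : ℕ) : Type := squeezedSubmodule d

namespace SqueezedSchwartz

variable {d : ℕ}

instance : AddCommGroup (SqueezedSchwartz d) := inferInstanceAs (AddCommGroup (squeezedSubmodule d))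

instance : Module ℂ (SqueezedSchwartz d) := inferInstanceAs (Module ℂ (squeezedSubmodule d))

instance : CoeFun (SqueezedSchwartz d) (fun _ => Space (d + 1) → ℂ) := ⟨fun f => f.1⟩

theorem add_apply (f g : SqueezedSchwartz d) (p : Space (d + 1)) : (f + g) p = f p + g p := rfl

theorem smul_apply (c : ℂ) (f : SqueezedSchwartz d) (p : Space (d + 1)) :
    (c • f) p = c * f p := rfl

theorem contDiffAt (f : SqueezedSchwartz d) (j : ℕ) (p : Space (d + 1)) :
    ContDiffAt ℝ j (f : Space (d + 1) → ℂ) p :=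
  f.2.1.contDiffAt.of_le (by exact_mod_cast le_top)

theorem bddAbove (f : SqueezedSchwartz d) (k : ℤ) (l j : ℕ) :
    BddAbove (Set.range fun p : {p : Space (d + 1) // p 0 ≠ 0} =>
      |p.1 0| ^ k * ‖perp p.1‖ ^ l * ‖iteratedFDeriv ℝ j (f : Space (d + 1) → ℂ) p.1‖) := by
  obtain ⟨C, hC⟩ := f.2.2 k l j
  exact ⟨C, by rintro _ ⟨p, rfl⟩; exact hC p.1 p.2⟩

/-- The seminorms `‖f‖_{k,l,j} = sup_{p⁺ ≠ 0} |p⁺|^k ‖p_⊥‖^l ‖D^j f(p)‖`, where `k ∈ ℤ`. -/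
protected def seminorm (k : ℤ) (l j : ℕ) : Seminorm ℂ (SqueezedSchwartz d) :=
  Seminorm.ofSMulLE
    (fun f => ⨆ p : {p : Space (d + 1) // p 0 ≠ 0},
      |p.1 0| ^ k * ‖perp p.1‖ ^ l * ‖iteratedFDeriv ℝ j (f : Space (d + 1) → ℂ) p.1‖)
    (by
      have : ∀ p, iteratedFDeriv ℝ j ((0 : SqueezedSchwartz d) : Space (d + 1) → ℂ) p = 0 := by
        intro p
        change iteratedFDeriv ℝ j (0 : Space (d + 1) → ℂ) p = 0
        rw [iteratedFDeriv_zero]; rfl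
      simp [this])
    (by
      intro f g
      refine Real.iSup_le (fun p => ?_)
        (add_nonneg (Real.iSup_nonneg fun _ => by positivity)
          (Real.iSup_nonneg fun _ => by positivity))
      have e : iteratedFDeriv ℝ j ((f + g : SqueezedSchwartz d) : Space (d + 1) → ℂ) p.1
          = iteratedFDeriv ℝ j (f : Space (d + 1) → ℂ) p.1
            + iteratedFDeriv ℝ j (g : Space (d + 1) → ℂ) p.1 :=
        iteratedFDeriv_add_apply (f.contDiffAt j p.1) (g.contDiffAt j p.1)
      rw [e]
      calc _ ≤ |p.1 0| ^ k * ‖perp p.1‖ ^ l *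
            (‖iteratedFDeriv ℝ j (f : Space (d + 1) → ℂ) p.1‖
              + ‖iteratedFDeriv ℝ j (g : Space (d + 1) → ℂ) p.1‖) := by
            gcongr; exact norm_add_le _ _
        _ ≤ _ := by
            rw [mul_add]
            exact add_le_add (le_ciSup (f.bddAbove k l j) p) (le_ciSup (g.bddAbove k l j) p))
    (by
      intro c f
      refine Real.iSup_le (fun p => ?_)
        (mul_nonneg (norm_nonneg _) (Real.iSup_nonneg fun _ => by positivity))
      have e : iteratedFDeriv ℝ j ((c • f : SqueezedSchwartz d) : Space (d + 1) → ℂ) p.1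
          = c • iteratedFDeriv ℝ j (f : Space (d + 1) → ℂ) p.1 :=
        iteratedFDeriv_const_smul_apply (f.contDiffAt j p.1)
      rw [e, norm_smul]
      calc _ = ‖c‖ * (|p.1 0| ^ k * ‖perp p.1‖ ^ l *
            ‖iteratedFDeriv ℝ j (f : Space (d + 1) → ℂ) p.1‖) := by ring
        _ ≤ _ := by gcongr; exact le_ciSup (f.bddAbove k l j) p)

/-- The family of all the seminorms `‖·‖_{k,l,j}`. -/
def seminormFamily (d : ℕ) : SeminormFamily ℂ (SqueezedSchwartz d) (ℤ × ℕ × ℕ) :=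
  fun i => SqueezedSchwartz.seminorm i.1 i.2.1 i.2.2

instance : TopologicalSpace (SqueezedSchwartz d) :=
  (seminormFamily d).moduleFilterBasis.topology

theorem withSeminorms (d : ℕ) : WithSeminorms (seminormFamily d) := ⟨rfl⟩

instance : IsTopologicalAddGroup (SqueezedSchwartz d) := (withSeminorms d).topologicalAddGroup

instance : ContinuousSMul ℂ (SqueezedSchwartz d) := (withSeminorms d).continuousSMul

end SqueezedSchwartz

/-- The space `𝓢'_{p⁺}(ℝ^n)` of squeezed generalized functions. -/
abbrev SqueezedDual (d : ℕ) : Type := SqueezedSchwartz d →L[ℂ] ℂ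

/-- `b.PairsTo φ z`: the function `φ` on `{p⁺ ≠ 0}` extends (by zero, necessarily) to an element
of `𝓢_{p⁺}(ℝ^n)`, and the pairing `(b, φ)` of `b` with it is `z`. The values of `φ` on
`{p⁺ = 0}` play no role, and the extension is unique because it is continuous. -/
def PairsTo {d : ℕ} (b : SqueezedDual d) (φ : Space (d + 1) → ℂ) (z : ℂ) : Prop :=
  ∃ h : SqueezedSchwartz d, (∀ p, p 0 ≠ 0 → h p = φ p) ∧ b h = z

theorem PairsTo.unique {d : ℕ} {b : SqueezedDual d} {φ : Space (d + 1) → ℂ} {z z' : ℂ}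
    (hz : PairsTo b φ z) (hz' : PairsTo b φ z') : z = z' := by
  obtain ⟨h, hh, rfl⟩ := hz
  obtain ⟨h', hh', rfl⟩ := hz'
  have hd : Dense {p : Space (d + 1) | p 0 ≠ 0} := by
    have ho : IsOpenMap (EuclideanSpace.proj 0 : Space (d + 1) →L[ℝ] ℝ) :=
      ContinuousLinearMap.isOpenMap _ fun y => ⟨EuclideanSpace.single 0 y, by simp⟩
    exact (dense_compl_singleton (0 : ℝ)).preimage ho
  have e : h = h' := Subtype.ext <| Continuous.ext_on hd h.2.1.continuous h'.2.1.continuous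
    fun p hp => (hh p hp).trans (hh' p hp).symm
  rw [e]

/-- `c = M b`, for a function `M` on `{p⁺ ≠ 0}`: `(c, f) = (b, M f)` for all `f ∈ 𝓢_{p⁺}(ℝ^n)`. -/
def IsMul {d : ℕ} (M : Space (d + 1) → ℂ) (b c : SqueezedDual d) : Prop :=
  ∀ f : SqueezedSchwartz d, PairsTo b (fun p => M p * f p) (c f)

/-! ### The mass shell -/

/-- The light-cone energy `ω̃(p⁺, p_⊥) = (p_⊥² + m²) / (2p⁺)`. -/
def lcEnergy {d : ℕ} (m : ℝ) (p : Space (d + 1)) : ℝ :=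
  (‖perp p‖ ^ 2 + m ^ 2) / (2 * p 0)

/-- The parametrization `Ω̃(p) = (p, ω̃(p))` of the mass shell `p̃² = m²`. -/
def shellPoint {d : ℕ} (m : ℝ) (p : Space (d + 1)) : Space (d + 2) :=
  WithLp.toLp 2 (Fin.snoc (fun i => p i) (lcEnergy m p))

/-- `v = b(p) δ(p̃² - m²)`: `(v, f) = (b, f(Ω̃(p)) / (2|p⁺|))` for all `f ∈ 𝓢(ℝ^{1+n})`. -/
def IsShellDelta {d : ℕ} (m : ℝ) (b : SqueezedDual d) (v : 𝓢'(Space (d + 2), ℂ)) : Prop :=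
  ∀ f : 𝓢(Space (d + 2), ℂ),
    PairsTo b (fun p => f (shellPoint m p) / ((2 * |p 0| : ℝ) : ℂ)) (v f)

/-- The light-cone Klein-Gordon equation `(2∂₊∂₋ - ∑ᵢ ∂ᵢ² + m²) u = 0`. -/
def SolvesLCKG {d : ℕ} (m : ℝ) (u : 𝓢'(Space (d + 2), ℂ)) : Prop :=
  (2 : ℂ) • ∂_{(EuclideanSpace.single 0 1 : Space (d + 2))}
      (∂_{(EuclideanSpace.single (Fin.last (d + 1)) 1 : Space (d + 2))} u)
    - ∑ i : Fin d, ∂_{(EuclideanSpace.single i.succ.castSucc 1 : Space (d + 2))}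
        (∂_{(EuclideanSpace.single i.succ.castSucc 1 : Space (d + 2))} u)
    + ((m ^ 2 : ℝ) : ℂ) • u = 0

/-! ### Tame generalized functions and tame restrictions -/

/-- `𝓢_{∂₋}(ℝ^{k+1}) = ⋂_{r ≥ 0} ∂₋^r 𝓢(ℝ^{k+1})`, where `∂₋` is the derivative in the direction of
the last coordinate `x⁻`; it carries the subspace topology. -/
def tameSchwartz (k : ℕ) : Submodule ℂ 𝓢(Space (k + 1), ℂ) :=
  ⨅ r : ℕ, LinearMap.range
    ((LineDeriv.lineDerivOpCLM ℂ 𝓢(Space (k + 1), ℂ)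
      (EuclideanSpace.single (Fin.last k) 1 : Space (k + 1))).toLinearMap ^ r)

/-- The space `𝓢'_{∂₋}(ℝ^{k+1})` of tame generalized functions. -/
abbrev TameDual (k : ℕ) : Type := tameSchwartz k →L[ℂ] ℂ

/-- The relaxation `u*` of a tempered distribution `u`: its restriction to `𝓢_{∂₋}`. -/
def relaxation {k : ℕ} (u : 𝓢'(Space (k + 1), ℂ)) : TameDual k where
  toLinearMap := u.toLinearMap ∘ₗ (tameSchwartz k).subtype
  cont := u.cont.comp continuous_subtype_val

/-- `w = 𝓕_LC⁻¹ c`, for `c ∈ 𝓢'_{p⁺}(ℝ^n)` and `w ∈ 𝓢'_{∂₋}(ℝ^n)`: for all `g ∈ 𝓢_{∂₋}(ℝ^n)`,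
`(w, g) = (c, 𝓕_LC⁻¹ g)`, where `𝓕_LC⁻¹ g` is a function of the momentum. -/
def IsSpatialFourierInv {d : ℕ} (c : SqueezedDual d) (w : TameDual d) : Prop :=
  ∀ g : tameSchwartz d, PairsTo c ((lcSpatialFourier d).symm (g : 𝓢(Space (d + 1), ℂ))) (w g)

/-- `(U_t)_{t ∈ Ω}` is a family in `𝓢'_{∂₋}(ℝ^n)` which exhibits `v ∈ 𝓢'_{∂₋}(ℝ^{1+n})` as
`C^∞`-dependent on the parameter `x⁺ ∈ Ω`: the function `t ↦ (U_t, g)` is `C^∞` on `Ω`, and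
`(v, f(x⁺) ⊗ g) = ∫_Ω (U_t, g) f(t) dt` for all `f ∈ 𝓓(Ω)` and `g ∈ 𝓢_{∂₋}(ℝ^n)`; here `φ` is
the element `f(x⁺) ⊗ g` of `𝓢_{∂₋}(ℝ^{1+n})`. The values of `U` outside `Ω` play no role. -/
def IsParameterFamily {d : ℕ} (Ω : Opens ℝ) (v : TameDual (d + 1)) (U : ℝ → TameDual d) : Prop :=
  (∀ g : tameSchwartz d, ContDiffOn ℝ ∞ (fun t => U t g) Ω) ∧
  ∀ (f : 𝓓(Ω, ℂ)) (g : tameSchwartz d), ∃ φ : tameSchwartz (d + 1),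
    (∀ x : Space (d + 2), (φ : 𝓢(Space (d + 2), ℂ)) x
      = f (x 0) * (g : 𝓢(Space (d + 1), ℂ)) (spatial x)) ∧
    v φ = ∫ t in (Ω : Set ℝ), U t g * f t

/-- `v` is `C^∞`-dependent on `x⁺ ∈ Ω` as a parameter. -/
def DependsSmoothly {d : ℕ} (Ω : Opens ℝ) (v : TameDual (d + 1)) : Prop :=
  ∃ U : ℝ → TameDual d, IsParameterFamily Ω v U

/-- `u` admits a tame restriction to `{x⁺ = 0}`. -/
def AdmitsTameRestriction {d : ℕ} (u : 𝓢'(Space (d + 2), ℂ)) : Prop :=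
  ∃ Ω : Opens ℝ, (0 : ℝ) ∈ Ω ∧ DependsSmoothly Ω (relaxation u)

end LightCone

end

noncomputable section

namespace LightCone

/-! ### Weights off the hyperplane `p⁺ = 0` -/

/-! Write w for `weight`. Squeezed Schwartz functions are the smooth functions on p⁺ ≠ 0 all of
whose derivatives decay faster than every power of w; such functions are flat at p⁺ = 0 and extend
by zero. Functions whose derivatives are bounded by powers of w (`IsMultiplier`) act on this space,
among them ω̃, 1/|p⁺| and e^{-iω̃t}. The analytic core is `IsMultiplier.exists_bound_comp`: for a
real multiplier λ, the pairing of a functional T with ψ(λ)F is controlled by finitely many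
derivatives of the one-variable function ψ. This gives a fundamental theorem of calculus for t ↦
T(∫_a^t g(r)e^{-iλr}dr · F), hence smoothness of t ↦ T(e^{-iλt}F) and the exchange of T with
integrals over t (`IsMultiplier.integral_expCLM`), without vector-valued integration.

A tame test function g is a ∂₋-derivative of every order, so its transform ĝ is divisible by every
power of p⁺ and is squeezed (`exists_tameFourier`). The transform of f ⊗ g is (2π)⁻¹ ∫
f(t)e^{-ip⁻t}dt times ĝ(p⁺, p_⊥) (`lcFourier_symm_tensor`).

For (i), m > 0 forces |p⁻| = |ω̃| to blow up like 1/|p⁺| on the shell, so a Schwartz function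
restricted to the shell is squeezed (`weight_le_shellPoint`, `exists_comp_shellPoint`) and the shell
distribution exists. Substituting p⁻ = ω̃ turns the pairing of u* with f ⊗ g into b applied to ∫
f(t)e^{-iω̃t}dt · ĝ/(4π|p⁺|), and the exchange lemma gives the formula. Continuity in t makes the
family unique.

For (ii), u need not be represented by some b. Let T be the transform of u on squeezed functions of
all momenta. As p⁺ is invertible there, the equation says (p⁻ - ω̃)T = 0, so T is invariant under
e^{-it(p⁻-ω̃)}. Averaging against η with integral 1 gives T = χ(p⁻ - ω̃)T, where χ is the transform
of η. The product χ(p⁻ - ω̃)ĝ is squeezed in all variables (`exists_spread`), so the exchange lemma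
applies to it, and (U_t, g) = (2π)⁻¹ T(e^{-iω̃t}χ(p⁻ - ω̃)ĝ) is the required smooth family. -/

/-- The open set `{p⁺ ≠ 0}`. -/
def offPlane (k : ℕ) : Set (Space (k + 1)) := {p | p 0 ≠ 0}

variable {k : ℕ}

theorem isOpen_offPlane (k : ℕ) : IsOpen (offPlane k) :=
  isOpen_ne.preimage (EuclideanSpace.proj 0 : Space (k + 1) →L[ℝ] ℝ).continuous

theorem dense_offPlane (k : ℕ) : Dense (offPlane k) := by
  have ho : IsOpenMap (EuclideanSpace.proj 0 : Space (k + 1) →L[ℝ] ℝ) :=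
    ContinuousLinearMap.isOpenMap _ fun y => ⟨EuclideanSpace.single 0 y, by simp⟩
  exact (dense_compl_singleton (0 : ℝ)).preimage ho

theorem norm_sq_eq_add_perp (p : Space (k + 1)) : ‖p‖ ^ 2 = (p 0) ^ 2 + ‖perp p‖ ^ 2 := by
  rw [EuclideanSpace.real_norm_sq_eq, EuclideanSpace.real_norm_sq_eq, Fin.sum_univ_succ]
  rfl

theorem norm_perp_le (p : Space (k + 1)) : ‖perp p‖ ≤ ‖p‖ := by
  refine (sq_le_sq₀ (norm_nonneg _) (norm_nonneg _)).1 ?_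
  rw [norm_sq_eq_add_perp p]
  nlinarith [sq_nonneg (p 0)]

theorem abs_coord_le (p : Space (k + 1)) (i : Fin (k + 1)) : |p i| ≤ ‖p‖ :=
  PiLp.norm_apply_le p i

theorem norm_le_abs_add_norm_perp (p : Space (k + 1)) : ‖p‖ ≤ |p 0| + ‖perp p‖ := by
  refine (sq_le_sq₀ (norm_nonneg _) (by positivity)).1 ?_
  rw [norm_sq_eq_add_perp p, ← sq_abs (p 0)]
  nlinarith [mul_nonneg (abs_nonneg (p 0)) (norm_nonneg (perp p))]

/-- The weight `1 + |p⁺| + |p⁺|⁻¹ + ‖p_⊥‖`, whose powers measure the decay of the elements of the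
squeezed Schwartz space. -/
def weight (p : Space (k + 1)) : ℝ := 1 + |p 0| + |p 0|⁻¹ + ‖perp p‖

theorem one_le_weight (p : Space (k + 1)) : 1 ≤ weight p := by
  have h1 := abs_nonneg (p 0)
  have h2 := inv_nonneg.2 h1
  have h3 := norm_nonneg (perp p)
  unfold weight; linarith

theorem weight_pos (p : Space (k + 1)) : 0 < weight p := one_pos.trans_le (one_le_weight p)

theorem abs_le_weight (p : Space (k + 1)) : |p 0| ≤ weight p := by
  have h2 := inv_nonneg.2 (abs_nonneg (p 0))
  have h3 := norm_nonneg (perp p)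
  unfold weight; linarith

theorem inv_abs_le_weight (p : Space (k + 1)) : |p 0|⁻¹ ≤ weight p := by
  have h2 := abs_nonneg (p 0)
  have h3 := norm_nonneg (perp p)
  unfold weight; linarith

theorem perp_le_weight (p : Space (k + 1)) : ‖perp p‖ ≤ weight p := by
  have h1 := abs_nonneg (p 0)
  have h2 := inv_nonneg.2 h1
  unfold weight; linarith

theorem one_add_norm_le_weight (p : Space (k + 1)) : 1 + ‖p‖ ≤ weight p := by
  have h1 := norm_le_abs_add_norm_perp p
  have h2 := inv_nonneg.2 (abs_nonneg (p 0))
  unfold weight; linarith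

theorem zpow_mul_pow_le_weight (p : Space (k + 1)) (m : ℤ) (l : ℕ) :
    |p 0| ^ m * ‖perp p‖ ^ l ≤ weight p ^ (m.natAbs + l) := by
  rw [pow_add]
  gcongr
  · exact pow_nonneg (weight_pos p).le _
  · rcases m.natAbs_eq with h | h
    · rw [h, zpow_natCast, Int.natAbs_natCast]
      gcongr; exact abs_le_weight p
    · rw [h, zpow_neg, ← inv_zpow, zpow_natCast, Int.natAbs_neg, Int.natAbs_natCast]
      gcongr; exact inv_abs_le_weight p
  · exact perp_le_weight p

/-- A sum of four nonnegative terms is at most four times the largest. This converts powers of the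
weight back into the monomials of the defining seminorms. -/
theorem weight_pow_le (p : Space (k + 1)) (N : ℕ) : weight p ^ N ≤
    4 ^ N * (1 + |p 0| ^ (N : ℤ) + |p 0| ^ (-N : ℤ) + ‖perp p‖ ^ N) := by
  have h1 := abs_nonneg (p 0)
  have h2 := inv_nonneg.2 h1
  have h3 := norm_nonneg (perp p)
  set M := max (max 1 |p 0|) (max |p 0|⁻¹ ‖perp p‖) with hM
  have hw : weight p ≤ 4 * M := by
    have a1 : (1 : ℝ) ≤ M := (le_max_left _ _).trans (le_max_left _ _)
    have a2 : |p 0| ≤ M := (le_max_right _ _).trans (le_max_left _ _)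
    have a3 : |p 0|⁻¹ ≤ M := (le_max_left _ _).trans (le_max_right _ _)
    have a4 : ‖perp p‖ ≤ M := (le_max_right _ _).trans (le_max_right _ _)
    unfold weight; linarith
  refine (pow_le_pow_left₀ (weight_pos p).le hw N).trans ?_
  rw [mul_pow]
  gcongr
  rw [zpow_neg, ← inv_zpow, zpow_natCast, zpow_natCast]
  have b2 := pow_nonneg h1 N
  have b3 := pow_nonneg h2 N
  have b4 := pow_nonneg h3 N
  rcases max_choice (max 1 |p 0|) (max |p 0|⁻¹ ‖perp p‖) with h | h <;> rw [hM, h]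
  · rcases max_choice 1 |p 0| with h | h <;> rw [h]
    · rw [one_pow]; linarith
    · linarith
  · rcases max_choice |p 0|⁻¹ ‖perp p‖ with h | h <;> rw [h] <;> linarith

/-! ### Extension by zero -/

/-- A function which vanishes on a hyperplane, and which is smooth off it with derivatives that
vanish to second order at it, is smooth. -/
theorem contDiff_of_flat (n : ℕ) : ∀ {V : Type} [NormedAddCommGroup V] [NormedSpace ℝ V]
    {G : Space (k + 1) → V}, ContDiffOn ℝ ∞ G (offPlane k) → (∀ p, p 0 = 0 → G p = 0) →
    (∀ j : ℕ, ∃ C : ℝ, ∀ p ∈ offPlane k, ‖iteratedFDeriv ℝ j G p‖ ≤ C * |p 0| ^ 2) →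
    ContDiff ℝ n G := by
  -- Quadratic vanishing makes G differentiable at the hyperplane with derivative zero. The
  -- induction reapplies this to `fderiv ℝ G`, so the target space has to vary.
  have key : ∀ {V : Type} [NormedAddCommGroup V] [NormedSpace ℝ V]
    {G : Space (k + 1) → V}, (∀ p, p 0 = 0 → G p = 0) →
    (∃ C : ℝ, ∀ p ∈ offPlane k, ‖iteratedFDeriv ℝ 0 G p‖ ≤ C * |p 0| ^ 2) →
    ∀ p, p 0 = 0 → HasFDerivAt G (0 : Space (k + 1) →L[ℝ] V) p := by
    intro V _ _ G h0 ⟨C, hC⟩ p hp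
    have hb : ∀ q, ‖G q‖ ≤ C * |q 0| ^ 2 := by
      intro q
      by_cases hq : q 0 = 0
      · simp [h0 q hq, hq]
      · simpa using hC q hq
    have hC0 : 0 ≤ C := by
      have := (norm_nonneg _).trans (hb (EuclideanSpace.single 0 1))
      simpa using this
    refine HasFDerivAt.of_isLittleO ?_
    simp only [h0 p hp, sub_zero, zero_apply]
    have h1 : (fun q => G q) =O[nhds p] fun q => ‖q - p‖ ^ 2 := by
      refine Asymptotics.IsBigO.of_bound C (Filter.Eventually.of_forall fun q => ?_)
      refine (hb q).trans ?_
      rw [norm_pow, norm_norm]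
      have : |q 0| ≤ ‖q - p‖ := by
        have := abs_coord_le (q - p) 0
        simpa [hp] using this
      gcongr
    refine h1.trans_isLittleO ?_
    have := Asymptotics.isLittleO_pow_sub_sub p (m := 2) (by norm_num)
    refine Asymptotics.IsLittleO.of_norm_right ?_
    simpa using this
  induction n with
  | zero =>
    intro V _ _ G hG h0 hb
    rw [Nat.cast_zero, contDiff_zero, continuous_iff_continuousAt]
    intro p
    by_cases hp : p 0 = 0
    · exact (key h0 (hb 0) p hp).continuousAt
    · exact (hG.continuousOn.continuousAt ((isOpen_offPlane k).mem_nhds hp))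
  | succ n ih =>
    intro V _ _ G hG h0 hb
    rw [Nat.cast_succ, contDiff_succ_iff_fderiv]
    refine ⟨fun p => ?_, by simp, ih ?_ ?_ ?_⟩
    · by_cases hp : p 0 = 0
      · exact (key h0 (hb 0) p hp).differentiableAt
      · exact (hG.contDiffAt ((isOpen_offPlane k).mem_nhds hp)).differentiableAt (by simp)
    · exact hG.fderiv_of_isOpen (isOpen_offPlane k) (by simp)
    · exact fun p hp => (key h0 (hb 0) p hp).fderiv
    · intro j
      obtain ⟨C, hC⟩ := hb (j + 1)
      exact ⟨C, fun p hp => by rw [norm_iteratedFDeriv_fderiv]; exact hC p hp⟩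

theorem SqueezedSchwartz.ext_off {f g : SqueezedSchwartz k} (h : ∀ p, p 0 ≠ 0 → f p = g p) :
    f = g :=
  Subtype.ext <| Continuous.ext_on (dense_offPlane k) f.2.1.continuous g.2.1.continuous h

theorem iteratedFDeriv_eq_of_eqOn {V : Type*} [NormedAddCommGroup V] [NormedSpace ℝ V]
    {F G : Space (k + 1) → V} (h : Set.EqOn F G (offPlane k)) (n : ℕ) {p : Space (k + 1)}
    (hp : p ∈ offPlane k) : iteratedFDeriv ℝ n F p = iteratedFDeriv ℝ n G p :=
  (Filter.EventuallyEq.iteratedFDeriv ℝ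
    (h.eventuallyEq_of_mem ((isOpen_offPlane k).mem_nhds hp)) n).self_of_nhds

/-- A function on `{p⁺ ≠ 0}` whose derivatives decay faster than every power of the weight extends
by zero to an element of the squeezed Schwartz space. -/
theorem SqueezedSchwartz.exists_of_decay {F : Space (k + 1) → ℂ}
    (hF : ContDiffOn ℝ ∞ F (offPlane k))
    (hb : ∀ N n : ℕ, ∃ C : ℝ, ∀ p ∈ offPlane k, weight p ^ N * ‖iteratedFDeriv ℝ n F p‖ ≤ C) :
    ∃ h : SqueezedSchwartz k, ∀ p, p 0 ≠ 0 → h p = F p := by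
  classical
  set G : Space (k + 1) → ℂ := (offPlane k).indicator F with hG
  have hFG : Set.EqOn G F (offPlane k) := fun p hp => Set.indicator_of_mem hp F
  have hsm : ContDiff ℝ ∞ G := by
    rw [contDiff_infty]
    intro n
    refine contDiff_of_flat n (hF.congr hFG)
      (fun p hp => Set.indicator_of_notMem (fun h : p ∈ offPlane k => h hp) F) fun j => ?_
    -- Two powers of the weight dominate |p⁺|⁻², which is the flatness that `contDiff_of_flat` asks
    -- for.
    obtain ⟨C, hC⟩ := hb 2 j
    refine ⟨C, fun p hp => ?_⟩
    rw [iteratedFDeriv_eq_of_eqOn hFG j hp]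
    have h1 : |p 0|⁻¹ ^ 2 * ‖iteratedFDeriv ℝ j F p‖ ≤ C := by
      refine le_trans ?_ (hC p hp)
      gcongr; exact inv_abs_le_weight p
    have hp' : 0 < |p 0| := abs_pos.2 hp
    calc ‖iteratedFDeriv ℝ j F p‖ = |p 0|⁻¹ ^ 2 * ‖iteratedFDeriv ℝ j F p‖ * |p 0| ^ 2 := by
          field_simp
      _ ≤ _ := by gcongr
  refine ⟨⟨G, hsm, fun m l j => ?_⟩, fun p hp => hFG hp⟩
  obtain ⟨C, hC⟩ := hb (m.natAbs + l) j
  refine ⟨C, fun p hp => ?_⟩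
  rw [iteratedFDeriv_eq_of_eqOn hFG j hp]
  refine le_trans ?_ (hC p hp)
  gcongr
  exact zpow_mul_pow_le_weight p m l

/-! ### Seminorms and functionals in terms of the weight -/

theorem SqueezedSchwartz.le_seminorm (f : SqueezedSchwartz k) (m : ℤ) (l j : ℕ)
    {p : Space (k + 1)} (hp : p ∈ offPlane k) :
    |p 0| ^ m * ‖perp p‖ ^ l * ‖iteratedFDeriv ℝ j (f : Space (k + 1) → ℂ) p‖
      ≤ SqueezedSchwartz.seminorm m l j f :=
  le_ciSup (f.bddAbove m l j) ⟨p, hp⟩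

theorem SqueezedSchwartz.seminorm_le (f : SqueezedSchwartz k) (m : ℤ) (l j : ℕ) {C : ℝ}
    (hC : ∀ p ∈ offPlane k, weight p ^ (m.natAbs + l) *
      ‖iteratedFDeriv ℝ j (f : Space (k + 1) → ℂ) p‖ ≤ C) (hC0 : 0 ≤ C) :
    SqueezedSchwartz.seminorm m l j f ≤ C := by
  refine Real.iSup_le (fun p => ?_) hC0
  refine le_trans ?_ (hC p.1 p.2)
  gcongr
  exact zpow_mul_pow_le_weight p.1 m l

theorem SqueezedSchwartz.continuous_seminorm (m : ℤ) (l j : ℕ) :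
    Continuous (SqueezedSchwartz.seminorm m l j : Seminorm ℂ (SqueezedSchwartz k)) :=
  (SqueezedSchwartz.withSeminorms k).continuous_seminorm (m, l, j)

/-- The weighted derivatives of order at most `J` are dominated by a continuous seminorm. -/
theorem SqueezedSchwartz.exists_seminorm (N J : ℕ) :
    ∃ q : Seminorm ℂ (SqueezedSchwartz k), Continuous q ∧
      ∀ (f : SqueezedSchwartz k), ∀ j ≤ J, ∀ p ∈ offPlane k,
        weight p ^ N * ‖iteratedFDeriv ℝ j (f : Space (k + 1) → ℂ) p‖ ≤ q f := by
  have one : ∀ j : ℕ, ∃ q : Seminorm ℂ (SqueezedSchwartz k), Continuous q ∧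
      ∀ (f : SqueezedSchwartz k), ∀ p ∈ offPlane k,
        weight p ^ N * ‖iteratedFDeriv ℝ j (f : Space (k + 1) → ℂ) p‖ ≤ q f := by
    intro j
    refine ⟨(4 ^ N : NNReal) • (SqueezedSchwartz.seminorm 0 0 j + SqueezedSchwartz.seminorm N 0 j +
      SqueezedSchwartz.seminorm (-N) 0 j + SqueezedSchwartz.seminorm 0 N j), ?_, ?_⟩
    · have := (SqueezedSchwartz.continuous_seminorm (k := k) 0 0 j).add
        (SqueezedSchwartz.continuous_seminorm N 0 j) |>.add
        (SqueezedSchwartz.continuous_seminorm (-N) 0 j) |>.add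
        (SqueezedSchwartz.continuous_seminorm 0 N j)
      exact this.const_smul (4 ^ N : NNReal)
    · intro f p hp
      have h1 := f.le_seminorm 0 0 j hp
      have h2 := f.le_seminorm N 0 j hp
      have h3 := f.le_seminorm (-N) 0 j hp
      have h4 := f.le_seminorm 0 N j hp
      have h5 := mul_le_mul_of_nonneg_right (weight_pow_le p N)
        (norm_nonneg (iteratedFDeriv ℝ j (f : Space (k + 1) → ℂ) p))
      refine h5.trans ?_
      change _ ≤ 4 ^ N * (SqueezedSchwartz.seminorm 0 0 j f + SqueezedSchwartz.seminorm N 0 j f +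
        SqueezedSchwartz.seminorm (-N) 0 j f + SqueezedSchwartz.seminorm 0 N j f)
      rw [mul_assoc]
      refine mul_le_mul_of_nonneg_left ?_ (by positivity)
      simp only [pow_zero, mul_one, zpow_zero, one_mul] at h1 h2 h3 h4
      linarith
  induction J with
  | zero =>
    obtain ⟨q, hq, hq'⟩ := one 0
    exact ⟨q, hq, fun f j hj p hp => by rw [Nat.le_zero.1 hj]; exact hq' f p hp⟩
  | succ J ih =>
    obtain ⟨q, hq, hq'⟩ := one (J + 1)
    obtain ⟨r, hr, hr'⟩ := ih
    refine ⟨q + r, hq.add hr, fun f j hj p hp => ?_⟩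
    change _ ≤ q f + r f
    have h1 := apply_nonneg q f
    have h2 := apply_nonneg r f
    rcases Nat.le_succ_iff.1 hj with h | h
    · linarith [hr' f j h p hp]
    · rw [h]
      linarith [hq' f p hp]

/-- A continuous functional on the squeezed Schwartz space is bounded by finitely many weighted
derivatives. -/
theorem SqueezedDual.exists_bound (T : SqueezedDual k) : ∃ (J N : ℕ) (C : ℝ), 0 ≤ C ∧
    ∀ (f : SqueezedSchwartz k) (B : ℝ), 0 ≤ B → (∀ j ≤ J, ∀ p ∈ offPlane k,
      weight p ^ N * ‖iteratedFDeriv ℝ j (f : Space (k + 1) → ℂ) p‖ ≤ B) → ‖T f‖ ≤ C * B := by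
  obtain ⟨s, C, -, hC⟩ := Seminorm.bound_of_continuous (SqueezedSchwartz.withSeminorms k)
    ((normSeminorm ℂ ℂ).comp T.toLinearMap) (continuous_norm.comp T.continuous)
  -- Finitely many seminorms bound T; J and N are the largest derivative order and the largest total
  -- weight exponent among them.
  refine ⟨s.sup fun i => i.2.2, s.sup fun i => i.1.natAbs + i.2.1, C, C.2, fun f B hB hf => ?_⟩
  refine (hC f).trans ?_
  change (C : ℝ) * (s.sup (SqueezedSchwartz.seminormFamily k)) f ≤ _
  gcongr
  refine Seminorm.finset_sup_apply_le hB fun i hi => ?_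
  refine f.seminorm_le _ _ _ (fun p hp => le_trans ?_
    (hf i.2.2 (Finset.le_sup (f := fun i => i.2.2) hi) p hp)) hB
  gcongr
  · exact one_le_weight p
  · exact Finset.le_sup (f := fun i : ℤ × ℕ × ℕ => i.1.natAbs + i.2.1) hi

/-- Construction of continuous linear maps into the squeezed Schwartz space. -/
theorem SqueezedSchwartz.exists_clm {V : Type*} [AddCommGroup V] [Module ℂ V] [TopologicalSpace V]
    [IsTopologicalAddGroup V] (L : V → Space (k + 1) → ℂ)
    (hadd : ∀ f g p, p 0 ≠ 0 → L (f + g) p = L f p + L g p)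
    (hsmul : ∀ (c : ℂ) f p, p 0 ≠ 0 → L (c • f) p = c * L f p)
    (hL : ∀ f, ContDiffOn ℝ ∞ (L f) (offPlane k))
    (hb : ∀ N n : ℕ, ∃ q : Seminorm ℂ V, Continuous q ∧ ∀ f, ∀ p ∈ offPlane k,
      weight p ^ N * ‖iteratedFDeriv ℝ n (L f) p‖ ≤ q f) :
    ∃ A : V →L[ℂ] SqueezedSchwartz k, ∀ f p, p 0 ≠ 0 → A f p = L f p := by
  have hex : ∀ f, ∃ h : SqueezedSchwartz k, ∀ p, p 0 ≠ 0 → h p = L f p := fun f =>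
    SqueezedSchwartz.exists_of_decay (hL f) fun N n => by
      obtain ⟨q, -, hq⟩ := hb N n
      exact ⟨q f, hq f⟩
  choose A hA using hex
  let A' : V →ₗ[ℂ] SqueezedSchwartz k :=
    { toFun := A
      map_add' := fun f g => SqueezedSchwartz.ext_off fun p hp => by
        rw [hA _ p hp, hadd f g p hp, SqueezedSchwartz.add_apply, hA f p hp, hA g p hp]
      map_smul' := fun c f => SqueezedSchwartz.ext_off fun p hp => by
        rw [hA _ p hp, hsmul c f p hp, RingHom.id_apply, SqueezedSchwartz.smul_apply, hA f p hp] }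
  refine ⟨⟨A', ?_⟩, fun f p hp => hA f p hp⟩
  refine (SqueezedSchwartz.withSeminorms k).continuous_of_continuous_comp A' fun i => ?_
  obtain ⟨q, hq, hq'⟩ := hb (i.1.natAbs + i.2.1) i.2.2
  refine Seminorm.continuous_of_le hq fun f => ?_
  refine (A f).seminorm_le _ _ _ (fun p hp => ?_) (apply_nonneg q f)
  rw [iteratedFDeriv_eq_of_eqOn (fun x hx => hA f x hx) _ hp]
  exact hq' f p hp

end LightCone

end

noncomputable section

namespace LightCone

/-! ### Multipliers -/

/-! ### Leibniz and chain rule bounds on open sets -/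

section Leibniz

variable {E : Type*} [NormedAddCommGroup E] [NormedSpace ℝ E]
  {F : Type*} [NormedAddCommGroup F] [NormedSpace ℝ F]
  {G : Type*} [NormedAddCommGroup G] [NormedSpace ℝ G]
  {A : Type*} [NormedRing A] [NormedAlgebra ℝ A]

/-- Leibniz' rule, with the binomial coefficients summed to 2ⁿ. -/
theorem norm_iteratedFDeriv_mul_le_two_pow {s : Set E} (hs : IsOpen s) {f g : E → A}
    (hf : ContDiffOn ℝ ∞ f s) (hg : ContDiffOn ℝ ∞ g s) {x : E} (hx : x ∈ s) {n : ℕ} {a b : ℝ}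
    (ha : ∀ i ≤ n, ‖iteratedFDeriv ℝ i f x‖ ≤ a) (hb : ∀ i ≤ n, ‖iteratedFDeriv ℝ i g x‖ ≤ b) :
    ‖iteratedFDeriv ℝ n (fun y => f y * g y) x‖ ≤ 2 ^ n * a * b := by
  have h := norm_iteratedFDerivWithin_mul_le hf hg hs.uniqueDiffOn hx (n := n)
    (by exact_mod_cast le_top)
  simp only [iteratedFDerivWithin_of_isOpen _ hs hx] at h
  refine h.trans ?_
  have h0 : 0 ≤ a := (norm_nonneg _).trans (ha 0 (Nat.zero_le _))
  calc _ ≤ ∑ i ∈ Finset.range (n + 1), (n.choose i : ℝ) * a * b := by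
        refine Finset.sum_le_sum fun i hi => ?_
        have hi' := Nat.lt_succ_iff.1 (Finset.mem_range.1 hi)
        gcongr
        · exact ha i hi'
        · exact hb _ (Nat.sub_le _ _)
    _ = _ := by
        rw [← Finset.sum_mul, ← Finset.sum_mul]
        congr 2
        exact_mod_cast Nat.sum_range_choose n

theorem norm_iteratedFDeriv_comp_le_of_isOpen {s : Set E} {t : Set F} (hs : IsOpen s)
    (ht : IsOpen t) {g : F → G} {f : E → F} (hg : ContDiffOn ℝ ∞ g t) (hf : ContDiffOn ℝ ∞ f s)
    (hst : Set.MapsTo f s t) {x : E} (hx : x ∈ s) {n : ℕ} {C D : ℝ}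
    (hC : ∀ i ≤ n, ‖iteratedFDeriv ℝ i g (f x)‖ ≤ C)
    (hD : ∀ i, 1 ≤ i → i ≤ n → ‖iteratedFDeriv ℝ i f x‖ ≤ D ^ i) :
    ‖iteratedFDeriv ℝ n (fun y => g (f y)) x‖ ≤ n.factorial * C * D ^ n := by
  have h := norm_iteratedFDerivWithin_comp_le hg hf (n := n) (by exact_mod_cast le_top)
    ht.uniqueDiffOn hs.uniqueDiffOn hst hx (C := C) (D := D)
    (fun i hi => by rw [iteratedFDerivWithin_of_isOpen _ ht (hst hx)]; exact hC i hi)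
    (fun i h1 hi => by rw [iteratedFDerivWithin_of_isOpen _ hs hx]; exact hD i h1 hi)
  rwa [iteratedFDerivWithin_of_isOpen _ hs hx] at h

end Leibniz

variable {k : ℕ}

/-- Smooth functions on `{p⁺ ≠ 0}` all of whose derivatives are bounded by powers of the weight. -/
def IsMultiplier {V : Type*} [NormedAddCommGroup V] [NormedSpace ℝ V]
    (M : Space (k + 1) → V) : Prop :=
  ContDiffOn ℝ ∞ M (offPlane k) ∧ ∀ n : ℕ, ∃ (N : ℕ) (C : ℝ),
    ∀ p ∈ offPlane k, ‖iteratedFDeriv ℝ n M p‖ ≤ C * weight p ^ N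

namespace IsMultiplier

variable {V : Type*} [NormedAddCommGroup V] [NormedSpace ℝ V]
  {W : Type*} [NormedAddCommGroup W] [NormedSpace ℝ W]

theorem uniform {M : Space (k + 1) → V} (hM : IsMultiplier M) (n : ℕ) :
    ∃ (N : ℕ) (C : ℝ), 1 ≤ C ∧ ∀ i ≤ n, ∀ p ∈ offPlane k,
      ‖iteratedFDeriv ℝ i M p‖ ≤ C * weight p ^ N := by
  choose N C h using hM.2
  refine ⟨(Finset.range (n + 1)).sup N, 1 + ∑ i ∈ Finset.range (n + 1), |C i|,
    le_add_of_nonneg_right (Finset.sum_nonneg fun i _ => abs_nonneg _), fun i hi p hp => ?_⟩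
  have hi' := Finset.mem_range.2 (Nat.lt_succ_of_le hi)
  refine (h i p hp).trans ?_
  have h1 : C i ≤ 1 + ∑ i ∈ Finset.range (n + 1), |C i| := by
    have := Finset.single_le_sum (f := fun i => |C i|) (fun i _ => abs_nonneg _) hi'
    have h2 := le_abs_self (C i)
    linarith
  have h3 : 0 ≤ 1 + ∑ i ∈ Finset.range (n + 1), |C i| :=
    add_nonneg zero_le_one (Finset.sum_nonneg fun i _ => abs_nonneg _)
  have h4 := weight_pos p
  gcongr
  · exact one_le_weight p
  · exact Finset.le_sup hi'

/-- The chain rule estimate wants the i-th derivative of the inner function bounded by an i-th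
power; since the common bound is at least 1, raising it to the power i ≥ 1 only enlarges it. -/
theorem uniform_pow {M : Space (k + 1) → V} (hM : IsMultiplier M) (n : ℕ) :
    ∃ (N : ℕ) (C : ℝ), 1 ≤ C ∧ (∀ p ∈ offPlane k, ‖M p‖ ≤ C * weight p ^ N) ∧
      ∀ p ∈ offPlane k, ∀ i, 1 ≤ i → i ≤ n →
      ‖iteratedFDeriv ℝ i M p‖ ≤ (C * weight p ^ N) ^ i := by
  obtain ⟨N, C, hC, h⟩ := hM.uniform n
  refine ⟨N, C, hC, fun p hp => by simpa using h 0 (Nat.zero_le _) p hp,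
    fun p hp i h1 hi => (h i hi p hp).trans (le_self_pow₀ ?_ (by omega))⟩
  exact one_le_mul_of_one_le_of_one_le hC (one_le_pow₀ (one_le_weight p))

theorem of_temperate {M : Space (k + 1) → V} (hM : M.HasTemperateGrowth) : IsMultiplier M := by
  refine ⟨hM.1.contDiffOn, fun n => ?_⟩
  obtain ⟨N, C, h⟩ := hM.2 n
  refine ⟨N, |C|, fun p _ => (h p).trans ?_⟩
  gcongr
  · exact le_abs_self C
  · exact one_add_norm_le_weight p

theorem const (c : V) : IsMultiplier (fun _ : Space (k + 1) => c) :=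
  of_temperate (Function.HasTemperateGrowth.const c)

theorem congr {M M' : Space (k + 1) → V} (hM : IsMultiplier M) (h : ∀ p, p 0 ≠ 0 → M' p = M p) :
    IsMultiplier M' := by
  refine ⟨hM.1.congr h, fun n => ?_⟩
  obtain ⟨N, C, hC⟩ := hM.2 n
  exact ⟨N, C, fun p hp => by rw [iteratedFDeriv_eq_of_eqOn h n hp]; exact hC p hp⟩

theorem add {f g : Space (k + 1) → V} (hf : IsMultiplier f) (hg : IsMultiplier g) :
    IsMultiplier (fun p => f p + g p) := by
  refine ⟨hf.1.add hg.1, fun n => ?_⟩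
  obtain ⟨N, C, hC, h⟩ := hf.uniform n
  obtain ⟨N', C', hC', h'⟩ := hg.uniform n
  refine ⟨N + N', C + C', fun p hp => ?_⟩
  have hp' := (isOpen_offPlane k).mem_nhds hp
  have e : iteratedFDeriv ℝ n (fun p => f p + g p) p
      = iteratedFDeriv ℝ n f p + iteratedFDeriv ℝ n g p :=
    iteratedFDeriv_add_apply ((hf.1.contDiffAt hp').of_le (by exact_mod_cast le_top))
      ((hg.1.contDiffAt hp').of_le (by exact_mod_cast le_top))
  rw [e]
  refine (norm_add_le _ _).trans ((add_le_add (h n le_rfl p hp) (h' n le_rfl p hp)).trans ?_)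
  rw [add_mul]
  have := one_le_weight p
  gcongr <;> omega

/-- Polynomial growth of g in f(p) becomes growth in powers of the weight, because f itself is
bounded by such a power. -/
theorem comp {f : Space (k + 1) → V} {g : V → W} (hf : IsMultiplier f)
    (hg : g.HasTemperateGrowth) : IsMultiplier (fun p => g (f p)) := by
  refine ⟨hg.1.comp_contDiffOn hf.1, fun n => ?_⟩
  obtain ⟨N, C, hC, h0, h⟩ := hf.uniform_pow n
  obtain ⟨K, C', hC', h'⟩ := hg.norm_iteratedFDeriv_le_uniform n
  refine ⟨N * K + N * n, n.factorial * (C' * (2 * C) ^ K) * C ^ n, fun p hp => ?_⟩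
  have h1 := norm_iteratedFDeriv_comp_le_of_isOpen (isOpen_offPlane k) isOpen_univ hg.1.contDiffOn
    hf.1 (Set.mapsTo_univ _ _) hp (n := n) (C := C' * (1 + ‖f p‖) ^ K) (fun i hi => h' i hi _)
    (h p hp)
  refine h1.trans ?_
  have hw : 1 ≤ weight p ^ N := one_le_pow₀ (one_le_weight p)
  have h2 : 1 + ‖f p‖ ≤ 2 * C * weight p ^ N := by
    have h3 := h0 p hp
    have h4 : 1 ≤ C * weight p ^ N := one_le_mul_of_one_le_of_one_le hC hw
    linarith
  calc _ ≤ n.factorial * (C' * (2 * C * weight p ^ N) ^ K) * (C * weight p ^ N) ^ n := by gcongr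
    _ = _ := by rw [pow_add, pow_mul, pow_mul, mul_pow, mul_pow _ _ n]; ring

theorem mul {A : Type*} [NormedRing A] [NormedAlgebra ℝ A] {f g : Space (k + 1) → A}
    (hf : IsMultiplier f) (hg : IsMultiplier g) : IsMultiplier (fun p => f p * g p) := by
  refine ⟨hf.1.mul hg.1, fun n => ?_⟩
  obtain ⟨N, C, hC, h⟩ := hf.uniform n
  obtain ⟨N', C', hC', h'⟩ := hg.uniform n
  refine ⟨N + N', 2 ^ n * C * C', fun p hp => ?_⟩
  refine (norm_iteratedFDeriv_mul_le_two_pow (isOpen_offPlane k) hf.1 hg.1 hp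
    (fun i hi => h i hi p hp) (fun i hi => h' i hi p hp)).trans (le_of_eq ?_)
  rw [pow_add]; ring

theorem ofReal {f : Space (k + 1) → ℝ} (hf : IsMultiplier f) :
    IsMultiplier (fun p => (f p : ℂ)) :=
  hf.comp (g := fun s : ℝ => (s : ℂ)) Complex.ofRealCLM.hasTemperateGrowth

theorem coord (i : Fin (k + 1)) : IsMultiplier (fun p : Space (k + 1) => p i) :=
  of_temperate (EuclideanSpace.proj i : Space (k + 1) →L[ℝ] ℝ).hasTemperateGrowth

/-- The hypothesis is the size of the derivatives of 1/x, and |p⁺|⁻¹ is dominated by the weight; it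
serves both 1/p⁺ and 1/|p⁺|. -/
theorem coord_comp {g : ℝ → ℝ} (hg : ContDiffOn ℝ ∞ g {0}ᶜ)
    (hb : ∀ i : ℕ, ∀ x, x ≠ 0 → ‖iteratedDeriv i g x‖ ≤ i.factorial * |x|⁻¹ ^ (i + 1)) :
    IsMultiplier (fun p : Space (k + 1) => g (p 0)) := by
  have hmaps : Set.MapsTo (fun p : Space (k + 1) => p 0) (offPlane k) {0}ᶜ := fun p hp => hp
  refine ⟨hg.comp (coord (k := k) 0).1 hmaps, fun n => ?_⟩
  obtain ⟨N, C, hC, h0, h⟩ := (coord (k := k) 0).uniform_pow n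
  refine ⟨(n + 1) + N * n, n.factorial * n.factorial * C ^ n, fun p hp => ?_⟩
  refine (norm_iteratedFDeriv_comp_le_of_isOpen (isOpen_offPlane k) isOpen_compl_singleton hg
    (coord (k := k) 0).1 hmaps hp (n := n) (C := n.factorial * weight p ^ (n + 1))
    (fun i hi => ?_) (h p hp)).trans (le_of_eq ?_)
  · rw [norm_iteratedFDeriv_eq_norm_iteratedDeriv]
    refine (hb i _ hp).trans ?_
    have := weight_pos p
    calc (i.factorial : ℝ) * |p 0|⁻¹ ^ (i + 1) ≤ n.factorial * weight p ^ (i + 1) := by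
          gcongr
          exact inv_abs_le_weight p
      _ ≤ _ := by
          gcongr
          exact one_le_weight p
  · rw [mul_pow, pow_add _ (n + 1), pow_mul]; ring

theorem norm_iteratedDeriv_inv (i : ℕ) (x : ℝ) :
    ‖iteratedDeriv i (fun x : ℝ => x⁻¹) x‖ = i.factorial * |x|⁻¹ ^ (i + 1) := by
  rw [iteratedDeriv_eq_iterate]
  have := iter_deriv_inv (𝕜 := ℝ) i x
  rw [show (fun x : ℝ => x⁻¹) = Inv.inv from rfl, this]
  rw [norm_mul, norm_mul, norm_pow, norm_neg, norm_one, one_pow, one_mul, Real.norm_natCast,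
    Real.norm_eq_abs, abs_zpow]
  congr 1
  rw [show (-1 - (i : ℤ)) = -((i + 1 : ℕ) : ℤ) by push_cast; ring, zpow_neg, zpow_natCast, inv_pow]

theorem inv_coord : IsMultiplier (fun p : Space (k + 1) => (p 0)⁻¹) :=
  coord_comp (g := fun x => x⁻¹) (fun _ hx => (contDiffAt_inv ℝ hx).contDiffWithinAt)
    fun i x _ => (norm_iteratedDeriv_inv i x).le

theorem abs_inv_coord : IsMultiplier (fun p : Space (k + 1) => |p 0|⁻¹) := by
  -- Away from 0 the function 1/|x| is locally 1/x or -1/x, so all derivative bounds are inherited.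
  have hloc : ∀ x : ℝ, x ≠ 0 → (fun x : ℝ => |x|⁻¹) =ᶠ[nhds x] (fun x : ℝ => x⁻¹) ∨
      (fun x : ℝ => |x|⁻¹) =ᶠ[nhds x] (fun x : ℝ => -x⁻¹) := by
    intro x hx
    rcases lt_or_gt_of_ne hx with h | h
    · right
      filter_upwards [gt_mem_nhds h] with y hy
      rw [abs_of_neg hy, inv_neg]
    · left
      filter_upwards [lt_mem_nhds h] with y hy
      rw [abs_of_pos hy]
  refine coord_comp (g := fun x => |x|⁻¹) (fun x hx => ContDiffAt.contDiffWithinAt ?_)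
    fun i x hx => ?_
  · rcases hloc x hx with h | h
    · exact (contDiffAt_inv ℝ hx).congr_of_eventuallyEq h
    · exact (contDiffAt_inv ℝ hx).neg.congr_of_eventuallyEq h
  · rcases hloc x hx with h | h
    · rw [h.iteratedDeriv_eq]
      exact (norm_iteratedDeriv_inv i x).le
    · rw [h.iteratedDeriv_eq, iteratedDeriv_fun_neg, norm_neg]
      exact (norm_iteratedDeriv_inv i x).le

end IsMultiplier

theorem SqueezedSchwartz.contDiffOn (f : SqueezedSchwartz k) :
    ContDiffOn ℝ ∞ (f : Space (k + 1) → ℂ) (offPlane k) := f.2.1.contDiffOn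

theorem IsMultiplier.exists_mul {M : Space (k + 1) → ℂ} (hM : IsMultiplier M) :
    ∃ A : SqueezedSchwartz k →L[ℂ] SqueezedSchwartz k, ∀ f p, p 0 ≠ 0 → A f p = M p * f p := by
  refine SqueezedSchwartz.exists_clm (V := SqueezedSchwartz k) (fun f p => M p * f p)
    (fun f g p _ => by rw [SqueezedSchwartz.add_apply]; ring)
    (fun c f p _ => by rw [SqueezedSchwartz.smul_apply]; ring)
    (fun f => hM.1.mul f.contDiffOn) fun N n => ?_
  obtain ⟨K, C, hC, h⟩ := hM.uniform n
  obtain ⟨q, hq, hq'⟩ := SqueezedSchwartz.exists_seminorm (k := k) (N + K) n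
  refine ⟨(Real.toNNReal (2 ^ n * C)) • q, hq.const_smul _, fun f p hp => ?_⟩
  have hw := weight_pos p
  have h1 := norm_iteratedFDeriv_mul_le_two_pow (isOpen_offPlane k) hM.1 f.contDiffOn hp
    (n := n) (a := C * weight p ^ K) (b := q f / weight p ^ (N + K))
    (fun i hi => h i hi p hp) (fun i hi => by
      rw [le_div_iff₀' (by positivity)]; exact hq' f i hi p hp)
  calc _ ≤ weight p ^ N * (2 ^ n * (C * weight p ^ K) * (q f / weight p ^ (N + K))) := by gcongr
    _ = (2 ^ n * C) * q f := by rw [pow_add]; field_simp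
    _ = Real.toNNReal (2 ^ n * C) * q f := by
        rw [Real.coe_toNNReal _ (by positivity)]

/-- Multiplication by a multiplier. -/
def IsMultiplier.mulCLM {M : Space (k + 1) → ℂ} (hM : IsMultiplier M) :
    SqueezedSchwartz k →L[ℂ] SqueezedSchwartz k := hM.exists_mul.choose

theorem IsMultiplier.mulCLM_apply {M : Space (k + 1) → ℂ} (hM : IsMultiplier M)
    (f : SqueezedSchwartz k) {p : Space (k + 1)} (hp : p 0 ≠ 0) : hM.mulCLM f p = M p * f p :=
  hM.exists_mul.choose_spec f p hp

end LightCone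

end

noncomputable section

namespace LightCone

/-! ### Exponentials and their integrals -/

theorem hasDerivAt_cexp_mul (t s : ℝ) :
    HasDerivAt (fun s : ℝ => Complex.exp (-Complex.I * s * t))
      (-Complex.I * t * Complex.exp (-Complex.I * s * t)) s := by
  have h : HasDerivAt (fun s : ℝ => -Complex.I * (s : ℂ) * t) (-Complex.I * 1 * t) s :=
    ((Complex.ofRealCLM.hasDerivAt (x := s)).const_mul (-Complex.I)).mul_const (t : ℂ)
  have h2 := h.cexp
  rw [mul_one, mul_comm] at h2
  exact h2

theorem norm_cexp_mul (t s : ℝ) : ‖Complex.exp (-Complex.I * s * t)‖ = 1 := by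
  rw [Complex.norm_exp]
  simp

theorem contDiff_cexp_mul (t : ℝ) :
    ContDiff ℝ ∞ (fun s : ℝ => Complex.exp (-Complex.I * s * t)) :=
  ((contDiff_const.mul Complex.ofRealCLM.contDiff).mul contDiff_const).cexp

theorem iteratedDeriv_cexp_mul (t : ℝ) (n : ℕ) :
    iteratedDeriv n (fun s : ℝ => Complex.exp (-Complex.I * s * t))
      = fun s : ℝ => (-Complex.I * t) ^ n * Complex.exp (-Complex.I * s * t) := by
  induction n with
  | zero => simp [iteratedDeriv_zero]
  | succ n ih =>
    rw [iteratedDeriv_succ, ih]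
    funext s
    rw [((hasDerivAt_cexp_mul t s).const_mul _).deriv, pow_succ]
    ring

theorem hasTemperateGrowth_cexp_mul (t : ℝ) :
    Function.HasTemperateGrowth (fun s : ℝ => Complex.exp (-Complex.I * s * t)) := by
  refine ⟨contDiff_cexp_mul t, fun n => ⟨0, |t| ^ n, fun s => ?_⟩⟩
  rw [norm_iteratedFDeriv_eq_norm_iteratedDeriv, iteratedDeriv_cexp_mul, norm_mul, norm_cexp_mul]
  simp

/-- The truncated Fourier integral `s ↦ ∫_a^b g(t) e^{-ist} dt`. -/
def expIntegral (a b : ℝ) (g : ℝ → ℂ) (s : ℝ) : ℂ :=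
  ∫ t in a..b, g t * Complex.exp (-Complex.I * s * t)

theorem continuous_mul_cexp {g : ℝ → ℂ} (hg : Continuous g) (s : ℝ) :
    Continuous fun t : ℝ => g t * Complex.exp (-Complex.I * s * t) := by fun_prop

theorem hasDerivAt_expIntegral (a b : ℝ) {g : ℝ → ℂ} (hg : Continuous g) (s : ℝ) :
    HasDerivAt (expIntegral a b g) (expIntegral a b (fun t => -Complex.I * t * g t) s) s := by
  have hg' : Continuous fun t : ℝ => -Complex.I * t * g t := by fun_prop
  refine (intervalIntegral.hasDerivAt_integral_of_dominated_loc_of_deriv_le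
    (F := fun (s t : ℝ) => g t * Complex.exp (-Complex.I * s * t))
    (F' := fun (s t : ℝ) => -Complex.I * t * g t * Complex.exp (-Complex.I * s * t))
    (bound := fun t => ‖-Complex.I * t * g t‖) (s := Set.univ) Filter.univ_mem
    (Filter.Eventually.of_forall fun s => (continuous_mul_cexp hg s).aestronglyMeasurable)
    ((continuous_mul_cexp hg s).intervalIntegrable _ _)
    (continuous_mul_cexp hg' s).aestronglyMeasurable
    (Filter.Eventually.of_forall fun t _ s _ => ?_) (hg'.norm.intervalIntegrable _ _)
    (Filter.Eventually.of_forall fun t _ s _ => ?_)).2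
  · rw [norm_mul, norm_cexp_mul, mul_one]
  · refine ((hasDerivAt_cexp_mul t s).const_mul (g t)).congr_deriv ?_
    ring

theorem iteratedDeriv_expIntegral (a b : ℝ) {g : ℝ → ℂ} (hg : Continuous g) (n : ℕ) :
    iteratedDeriv n (expIntegral a b g) = expIntegral a b (fun t => (-Complex.I * t) ^ n * g t) := by
  induction n with
  | zero => simp [iteratedDeriv_zero]
  | succ n ih =>
    rw [iteratedDeriv_succ, ih]
    funext s
    rw [(hasDerivAt_expIntegral a b (g := fun t => (-Complex.I * t) ^ n * g t) (by fun_prop)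
      s).deriv]
    congr 1
    funext t
    rw [pow_succ]; ring

theorem contDiff_expIntegral (a b : ℝ) {g : ℝ → ℂ} (hg : Continuous g) :
    ContDiff ℝ ∞ (expIntegral a b g) := by
  refine contDiff_of_differentiable_iteratedDeriv fun n _ => ?_
  rw [iteratedDeriv_expIntegral a b hg]
  exact fun s => (hasDerivAt_expIntegral a b (g := fun t => (-Complex.I * t) ^ n * g t)
    (by fun_prop) s).differentiableAt

theorem norm_expIntegral_le (a b : ℝ) {g : ℝ → ℂ} {C : ℝ} (s : ℝ)
    (hC : ∀ t ∈ Set.uIoc a b, ‖g t‖ ≤ C) : ‖expIntegral a b g s‖ ≤ C * |b - a| :=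
  intervalIntegral.norm_integral_le_of_norm_le_const fun t ht => by
    rw [norm_mul, norm_cexp_mul, mul_one]; exact hC t ht

theorem hasTemperateGrowth_expIntegral (a b : ℝ) {g : ℝ → ℂ} (hg : Continuous g) :
    (expIntegral a b g).HasTemperateGrowth := by
  refine ⟨contDiff_expIntegral a b hg, fun n => ?_⟩
  obtain ⟨C, hC⟩ := (isCompact_uIcc (a := a) (b := b)).exists_bound_of_continuousOn
    (f := fun t : ℝ => (-Complex.I * t) ^ n * g t) (by fun_prop)
  refine ⟨0, C * |b - a|, fun s => ?_⟩
  rw [norm_iteratedFDeriv_eq_norm_iteratedDeriv, iteratedDeriv_expIntegral a b hg, pow_zero,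
    mul_one]
  exact norm_expIntegral_le a b s fun t ht => hC t (Set.uIoc_subset_uIcc ht)

/-- Local uniform continuity in `t` of the derivatives of `s ↦ g(t) e^{-ist}`. -/
theorem eventually_norm_mul_cexp_sub_le {g : ℝ → ℂ} (hg : Continuous g) (τ : ℝ) (J : ℕ) {ε : ℝ}
    (hε : 0 < ε) : ∀ᶠ t : ℝ in nhds τ, ∀ j ≤ J, ∀ s : ℝ,
      ‖(-Complex.I * t) ^ j * g t * Complex.exp (-Complex.I * s * t) -
        (-Complex.I * τ) ^ j * g τ * Complex.exp (-Complex.I * s * τ)‖ ≤ ε * (1 + |s|) := by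
  have key : ∀ j : ℕ, ∀ᶠ t : ℝ in nhds τ, ∀ s : ℝ,
      ‖(-Complex.I * t) ^ j * g t * Complex.exp (-Complex.I * s * t) -
        (-Complex.I * τ) ^ j * g τ * Complex.exp (-Complex.I * s * τ)‖ ≤ ε * (1 + |s|) := by
    intro j
    set c : ℝ → ℂ := fun t => (-Complex.I * t) ^ j * g t with hc
    have hcc : Continuous c := by fun_prop
    have h1 : ∀ᶠ t : ℝ in nhds τ, ‖c t - c τ‖ < ε := by
      have := (continuous_iff_continuousAt.1 hcc τ).sub_const (c τ) |>.norm
      exact this.eventually_lt_const (by simpa using hε)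
    have h2 : ∀ᶠ t : ℝ in nhds τ, ‖c τ‖ * |t - τ| < ε := by
      have : ContinuousAt (fun t : ℝ => ‖c τ‖ * |t - τ|) τ := by fun_prop
      exact this.eventually_lt_const (by simpa using hε)
    filter_upwards [h1, h2] with t h1 h2 s
    -- The exponential is Lipschitz in t only with constant |s|; this is the source of the factor 1
    -- + |s|.
    have h3 : ‖Complex.exp (-Complex.I * s * t) - Complex.exp (-Complex.I * s * τ)‖
        ≤ |s| * |t - τ| := by
      have e : Complex.exp (-Complex.I * s * t) - Complex.exp (-Complex.I * s * τ)
          = Complex.exp (-Complex.I * s * τ) *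
            (Complex.exp (Complex.I * ((-(s * (t - τ)) : ℝ) : ℂ)) - 1) := by
        rw [mul_sub, ← Complex.exp_add, mul_one]
        congr 2
        push_cast; ring
      rw [e, norm_mul, norm_cexp_mul, one_mul]
      refine (Real.norm_exp_I_mul_ofReal_sub_one_le).trans (le_of_eq ?_)
      rw [norm_neg, norm_mul, Real.norm_eq_abs, Real.norm_eq_abs]
    have e : (-Complex.I * t) ^ j * g t * Complex.exp (-Complex.I * s * t) -
        (-Complex.I * τ) ^ j * g τ * Complex.exp (-Complex.I * s * τ)
        = (c t - c τ) * Complex.exp (-Complex.I * s * t) +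
          c τ * (Complex.exp (-Complex.I * s * t) - Complex.exp (-Complex.I * s * τ)) := by
      simp only [hc]; ring
    rw [e]
    calc _ ≤ ‖c t - c τ‖ * 1 + ‖c τ‖ * (|s| * |t - τ|) := by
          refine (norm_add_le _ _).trans ?_
          rw [norm_mul, norm_mul, norm_cexp_mul]
          gcongr
      _ ≤ ε + ε * |s| := by
          have : ‖c τ‖ * (|s| * |t - τ|) = ‖c τ‖ * |t - τ| * |s| := by ring
          rw [this, mul_one]
          gcongr
      _ = _ := by ring
  have := (Filter.eventually_all_finset (Finset.range (J + 1))).2 fun j _ => key j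
  filter_upwards [this] with t ht j hj
  exact ht j (Finset.mem_range.2 (Nat.lt_succ_of_le hj))

/-! ### Functions of a real multiplier -/

variable {k : ℕ} {lam : Space (k + 1) → ℝ}

theorem IsMultiplier.cexp_mul (hl : IsMultiplier lam) (t : ℝ) :
    IsMultiplier (fun p => Complex.exp (-Complex.I * lam p * t)) :=
  hl.comp (hasTemperateGrowth_cexp_mul t)

/-- Multiplication by `e^{-iλt}`. -/
def IsMultiplier.expCLM (hl : IsMultiplier lam) (t : ℝ) :
    SqueezedSchwartz k →L[ℂ] SqueezedSchwartz k := (hl.cexp_mul t).mulCLM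

theorem IsMultiplier.expCLM_apply (hl : IsMultiplier lam) (t : ℝ) (f : SqueezedSchwartz k)
    {p : Space (k + 1)} (hp : p 0 ≠ 0) :
    hl.expCLM t f p = Complex.exp (-Complex.I * lam p * t) * f p := mulCLM_apply _ f hp

/-- T sees only finitely many weighted derivatives, and the growth 1 + |λ| together with the chain
rule costs only powers of the weight, which F absorbs. Convergence in the squeezed space is thereby
reduced to estimates for scalar functions of s, uniform up to a factor 1 + |s|. -/
theorem IsMultiplier.exists_bound_comp (hl : IsMultiplier lam) (T : SqueezedDual k)
    (F : SqueezedSchwartz k) : ∃ (J : ℕ) (C : ℝ), 0 ≤ C ∧ ∀ (ψ : ℝ → ℂ) (H : SqueezedSchwartz k)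
      (B : ℝ), ContDiff ℝ ∞ ψ → (∀ p, p 0 ≠ 0 → H p = ψ (lam p) * F p) → 0 ≤ B →
      (∀ j ≤ J, ∀ s, ‖iteratedDeriv j ψ s‖ ≤ B * (1 + |s|)) → ‖T H‖ ≤ C * B := by
  obtain ⟨J, N, C, hC, hT⟩ := T.exists_bound
  obtain ⟨M, D, hD, h0, h⟩ := hl.uniform_pow J
  -- The exponent budget: N from T, M from the factor 1 + |λ|, and M J from the derivatives of λ in
  -- the chain rule.
  obtain ⟨q, -, hq⟩ := SqueezedSchwartz.exists_seminorm (k := k) (N + (M + M * J)) J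
  refine ⟨J, C * (2 ^ J * (J.factorial * (2 * D) * D ^ J) * q F), by positivity,
    fun ψ H B hψ hH hB hb => ?_⟩
  rw [mul_assoc]
  refine hT H _ (by positivity) fun j hj p hp => ?_
  rw [iteratedFDeriv_eq_of_eqOn hH j hp]
  have hw := weight_pos p
  have hw1 : 1 ≤ weight p ^ M := one_le_pow₀ (one_le_weight p)
  have h2 : 1 + |lam p| ≤ 2 * D * weight p ^ M := by
    have h3 := h0 p hp
    rw [Real.norm_eq_abs] at h3
    have h4 : 1 ≤ D * weight p ^ M := one_le_mul_of_one_le_of_one_le hD hw1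
    linarith
  have hDw : 1 ≤ D * weight p ^ M := one_le_mul_of_one_le_of_one_le hD hw1
  have hcomp : ∀ i ≤ j, ‖iteratedFDeriv ℝ i (fun p => ψ (lam p)) p‖ ≤
      J.factorial * (B * (2 * D * weight p ^ M)) * (D * weight p ^ M) ^ J := by
    intro i hi
    refine (norm_iteratedFDeriv_comp_le_of_isOpen (isOpen_offPlane k) isOpen_univ
      hψ.contDiffOn hl.1 (Set.mapsTo_univ _ _) hp (n := i) (C := B * (2 * D * weight p ^ M))
      (fun l hli => ?_) (fun l h1 hli => h p hp l h1 (by omega))).trans ?_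
    · rw [norm_iteratedFDeriv_eq_norm_iteratedDeriv]
      refine (hb l (by omega) _).trans ?_
      gcongr
    · gcongr
      · exact hi.trans hj
      · exact hi.trans hj
  have h1 := norm_iteratedFDeriv_mul_le_two_pow (isOpen_offPlane k)
    (hψ.comp_contDiffOn hl.1) F.contDiffOn hp (n := j)
    (b := q F / weight p ^ (N + (M + M * J))) hcomp (fun i hi => by
      rw [le_div_iff₀' (by positivity)]; exact hq F i (hi.trans hj) p hp)
  calc _ ≤ weight p ^ N * (2 ^ j * (J.factorial * (B * (2 * D * weight p ^ M)) *
        (D * weight p ^ M) ^ J) * (q F / weight p ^ (N + (M + M * J)))) := by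
        gcongr; exact h1
    _ = 2 ^ j * (J.factorial * (2 * D) * D ^ J) * q F * B := by
        rw [pow_add, pow_add, pow_mul, mul_pow]; field_simp
    _ ≤ _ := by
        have : (0 : ℝ) ≤ J.factorial * (2 * D) * D ^ J := by positivity
        gcongr
        norm_num

end LightCone

end

noncomputable section

namespace LightCone

variable {k : ℕ} {lam : Space (k + 1) → ℝ}

theorem SqueezedSchwartz.sub_apply (f g : SqueezedSchwartz k) (p : Space (k + 1)) :
    (f - g) p = f p - g p := rfl

/-! ### The one-parameter group `e^{-iλt}` -/

/-- Multiplication by `∫_a^b g(t) e^{-iλt} dt`. -/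
def IsMultiplier.expIntegralCLM (hl : IsMultiplier lam) (a b : ℝ) {g : ℝ → ℂ}
    (hg : Continuous g) : SqueezedSchwartz k →L[ℂ] SqueezedSchwartz k :=
  (hl.comp (hasTemperateGrowth_expIntegral a b hg)).mulCLM

theorem IsMultiplier.expIntegralCLM_apply (hl : IsMultiplier lam) (a b : ℝ) {g : ℝ → ℂ}
    (hg : Continuous g) (f : SqueezedSchwartz k) {p : Space (k + 1)} (hp : p 0 ≠ 0) :
    hl.expIntegralCLM a b hg f p = expIntegral a b g (lam p) * f p := mulCLM_apply _ f hp

theorem IsMultiplier.continuous_expCLM (hl : IsMultiplier lam) (T : SqueezedDual k)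
    (F : SqueezedSchwartz k) : Continuous fun t => T (hl.expCLM t F) := by
  obtain ⟨J, C, hC, h⟩ := hl.exists_bound_comp T F
  rw [continuous_iff_continuousAt]
  intro τ
  refine Metric.continuousAt_iff'.2 fun ε hε => ?_
  -- Dividing by C + 1 rather than C covers C = 0.
  have hε' : 0 < ε / (C + 1) := by positivity
  filter_upwards [eventually_norm_mul_cexp_sub_le (g := fun _ => 1) continuous_const τ J hε']
    with t ht
  rw [dist_eq_norm, ← map_sub]
  refine (h (fun s => Complex.exp (-Complex.I * s * t) - Complex.exp (-Complex.I * s * τ)) _ _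
    ((contDiff_cexp_mul t).sub (contDiff_cexp_mul τ)) (fun p hp => ?_) hε'.le
    fun j hj s => ?_).trans_lt ?_
  · rw [SqueezedSchwartz.sub_apply, hl.expCLM_apply t F hp, hl.expCLM_apply τ F hp]; ring
  · have e := iteratedDeriv_sub (n := j) (x := s)
      ((contDiff_cexp_mul t).contDiffAt.of_le (by exact_mod_cast le_top))
      ((contDiff_cexp_mul τ).contDiffAt.of_le (by exact_mod_cast le_top))
    rw [show (fun s : ℝ => Complex.exp (-Complex.I * s * t) - Complex.exp (-Complex.I * s * τ))
      = (fun s : ℝ => Complex.exp (-Complex.I * s * t)) -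
        (fun s : ℝ => Complex.exp (-Complex.I * s * τ)) from rfl, e,
      iteratedDeriv_cexp_mul, iteratedDeriv_cexp_mul]
    simpa using ht j hj s
  · rw [mul_div_assoc', div_lt_iff₀ (by positivity)]
    nlinarith

/-- The first-order remainder is ψ(λ)F with ψ(s) = ∫_τ^t (g(r)e^{-isr} - g(τ)e^{-isτ})dr. Each
derivative of ψ is at most ε|t - τ|(1 + |s|) for t near τ, so `exists_bound_comp` makes the
remainder o(t - τ) after pairing with T. -/
theorem IsMultiplier.hasDerivAt_expIntegralCLM (hl : IsMultiplier lam) (T : SqueezedDual k)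
    (F : SqueezedSchwartz k) (a : ℝ) {g : ℝ → ℂ} (hg : Continuous g) (τ : ℝ) :
    HasDerivAt (fun t => T (hl.expIntegralCLM a t hg F)) (g τ * T (hl.expCLM τ F)) τ := by
  obtain ⟨J, C, hC, h⟩ := hl.exists_bound_comp T F
  rw [hasDerivAt_iff_isLittleO, Asymptotics.isLittleO_iff]
  intro ε hε
  have hε' : 0 < ε / (C + 1) := by positivity
  obtain ⟨δ, hδ, hball⟩ := Metric.eventually_nhds_iff_ball.1
    (eventually_norm_mul_cexp_sub_le hg τ J hε')
  filter_upwards [Metric.ball_mem_nhds τ hδ] with t ht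
  have e : T (hl.expIntegralCLM a t hg F) - T (hl.expIntegralCLM a τ hg F)
      - (t - τ) • (g τ * T (hl.expCLM τ F)) = T (hl.expIntegralCLM a t hg F
        - hl.expIntegralCLM a τ hg F - (((t - τ : ℝ) : ℂ) * g τ) • hl.expCLM τ F) := by
    rw [map_sub, map_sub, map_smul, smul_eq_mul, Complex.real_smul, mul_assoc]
  rw [e]
  have hcont : ∀ s : ℝ, ∀ u v : ℝ, IntervalIntegrable
      (fun t : ℝ => g t * Complex.exp (-Complex.I * s * t)) volume u v := fun s u v =>
    (continuous_mul_cexp hg s).intervalIntegrable u v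
  refine (h (fun s => expIntegral τ t g s -
      ((t - τ : ℝ) : ℂ) * g τ * Complex.exp (-Complex.I * s * τ)) _
    (ε / (C + 1) * |t - τ|) ((contDiff_expIntegral τ t hg).sub
      (contDiff_const.mul (contDiff_cexp_mul τ))) (fun p hp => ?_) (by positivity)
    fun j hj s => ?_).trans ?_
  · rw [SqueezedSchwartz.sub_apply, SqueezedSchwartz.sub_apply, SqueezedSchwartz.smul_apply,
      hl.expIntegralCLM_apply _ _ _ _ hp, hl.expIntegralCLM_apply _ _ _ _ hp,
      hl.expCLM_apply _ _ hp]
    have : expIntegral τ t g (lam p) = expIntegral a t g (lam p) - expIntegral a τ g (lam p) :=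
      (intervalIntegral.integral_interval_sub_left (hcont _ _ _) (hcont _ _ _)).symm
    rw [this]; ring
  · have e := iteratedDeriv_sub (n := j) (x := s)
      ((contDiff_expIntegral τ t hg).contDiffAt.of_le (by exact_mod_cast le_top))
      ((contDiff_const (c := ((t - τ : ℝ) : ℂ) * g τ) |>.mul
        (contDiff_cexp_mul τ)).contDiffAt.of_le (by exact_mod_cast le_top))
    rw [show (fun s : ℝ => expIntegral τ t g s -
        ((t - τ : ℝ) : ℂ) * g τ * Complex.exp (-Complex.I * s * τ))
      = expIntegral τ t g - (fun s : ℝ =>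
        ((t - τ : ℝ) : ℂ) * g τ * Complex.exp (-Complex.I * s * τ)) from rfl, e,
      iteratedDeriv_const_mul_field, iteratedDeriv_cexp_mul, iteratedDeriv_expIntegral _ _ hg]
    have e2 : expIntegral τ t (fun t => (-Complex.I * t) ^ j * g t) s - ((t - τ : ℝ) : ℂ) * g τ *
        ((-Complex.I * τ) ^ j * Complex.exp (-Complex.I * s * τ)) =
        ∫ r in τ..t, ((-Complex.I * r) ^ j * g r * Complex.exp (-Complex.I * s * r) -
          (-Complex.I * τ) ^ j * g τ * Complex.exp (-Complex.I * s * τ)) := by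
      rw [intervalIntegral.integral_sub ((continuous_mul_cexp
        (g := fun t => (-Complex.I * t) ^ j * g t) (by fun_prop) s).intervalIntegrable _ _)
        (by simp), intervalIntegral.integral_const, Complex.real_smul]
      unfold expIntegral
      ring
    rw [e2]
    refine (intervalIntegral.norm_integral_le_of_norm_le_const (C := ε / (C + 1) * (1 + |s|))
      fun r hr => hball r ?_ j hj s).trans (le_of_eq (by ring))
    have h1 := Set.abs_sub_left_of_mem_uIcc (Set.uIoc_subset_uIcc hr)
    rw [Metric.mem_ball, Real.dist_eq] at ht ⊢
    exact h1.trans_lt ht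
  · rw [Real.norm_eq_abs]
    have : C * (ε / (C + 1) * |t - τ|) = ε * |t - τ| * (C / (C + 1)) := by ring
    rw [this]
    refine mul_le_of_le_one_right (by positivity) ?_
    rw [div_le_one (by positivity)]
    linarith

/-- Interchange of a squeezed generalized function with an integral over the parameter. -/
theorem IsMultiplier.integral_expCLM (hl : IsMultiplier lam) (T : SqueezedDual k)
    (F H : SqueezedSchwartz k) {g : ℝ → ℂ} (hg : Continuous g) (hc : HasCompactSupport g)
    (hH : ∀ p, p 0 ≠ 0 → H p = (∫ t : ℝ, g t * Complex.exp (-Complex.I * lam p * t)) * F p) :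
    T H = ∫ t : ℝ, g t * T (hl.expCLM t F) := by
  obtain ⟨R, hR⟩ := hc.isCompact.isBounded.subset_ball 0
  have hzero : ∀ {f : ℝ → ℂ}, Function.support (fun t => g t * f t) ⊆ Set.Ioc (-R) R := by
    intro f t ht
    have h1 : t ∈ tsupport g := subset_tsupport g fun h0 => ht (by simp [h0])
    have := hR h1
    rw [mem_ball_zero_iff, Real.norm_eq_abs, abs_lt] at this
    exact ⟨this.1, this.2.le⟩
  have h1 : H = hl.expIntegralCLM (-R) R hg F := SqueezedSchwartz.ext_off fun p hp => by
    rw [hH p hp, hl.expIntegralCLM_apply _ _ hg F hp, expIntegral,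
      intervalIntegral.integral_eq_integral_of_support_subset hzero]
  -- Both sides of the exchange are increments over the support of g of the same primitive, which
  -- vanishes at -R.
  have h2 := intervalIntegral.integral_eq_sub_of_hasDerivAt (a := -R) (b := R)
    (fun t _ => hl.hasDerivAt_expIntegralCLM T F (-R) hg t)
    ((hg.mul (hl.continuous_expCLM T F)).intervalIntegrable _ _)
  have h3 : hl.expIntegralCLM (-R) (-R) hg F = 0 := SqueezedSchwartz.ext_off fun p hp => by
    rw [hl.expIntegralCLM_apply _ _ hg F hp, expIntegral, intervalIntegral.integral_same, zero_mul]
    rfl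
  rw [h3, map_zero, sub_zero, ← h1] at h2
  rw [← h2, intervalIntegral.integral_eq_integral_of_support_subset hzero]

/-- Writing e^{-iλτ} = 1 - i∫_0^τ e^{-iλt}dt · λ reduces this to the previous derivative with g = 1
and λF in place of F. Iterating in F gives smoothness. -/
theorem IsMultiplier.hasDerivAt_expCLM (hl : IsMultiplier lam) (T : SqueezedDual k)
    (F : SqueezedSchwartz k) (t : ℝ) : HasDerivAt (fun t => T (hl.expCLM t F))
      (-Complex.I * T (hl.expCLM t (hl.ofReal.mulCLM F))) t := by
  have h1 := (hl.hasDerivAt_expIntegralCLM T (hl.ofReal.mulCLM F) 0 (g := fun _ => 1)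
    continuous_const t).const_mul (-Complex.I) |>.const_add (T F)
  rw [one_mul] at h1
  refine h1.congr_of_eventuallyEq (Filter.Eventually.of_forall fun τ => ?_)
  have : hl.expCLM τ F = F + (-Complex.I) •
      hl.expIntegralCLM 0 τ (g := fun _ => 1) continuous_const (hl.ofReal.mulCLM F) := by
    refine SqueezedSchwartz.ext_off fun p hp => ?_
    rw [SqueezedSchwartz.add_apply, SqueezedSchwartz.smul_apply, hl.expCLM_apply _ _ hp,
      hl.expIntegralCLM_apply _ _ _ _ hp, hl.ofReal.mulCLM_apply _ hp]
    have h2 : ∫ t in (0 : ℝ)..τ, -Complex.I * lam p * Complex.exp (-Complex.I * lam p * t) =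
        Complex.exp (-Complex.I * lam p * τ) - 1 := by
      rw [intervalIntegral.integral_eq_sub_of_hasDerivAt
        (f := fun t : ℝ => Complex.exp (-Complex.I * lam p * t))]
      · simp
      · intro t _
        have h := hasDerivAt_cexp_mul (lam p) t
        refine (h.congr_deriv ?_).congr_of_eventuallyEq (Filter.Eventually.of_forall fun t => ?_)
        · congr 2; ring
        · change Complex.exp _ = Complex.exp _
          congr 1; ring
      · exact Continuous.intervalIntegrable (by fun_prop) _ _
    rw [intervalIntegral.integral_const_mul] at h2
    unfold expIntegral
    simp only [one_mul]
    linear_combination (-F p) * h2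
  simp only [this, map_add, map_smul, smul_eq_mul]

theorem IsMultiplier.contDiff_expCLM (hl : IsMultiplier lam) (T : SqueezedDual k)
    (F : SqueezedSchwartz k) : ContDiff ℝ ∞ fun t => T (hl.expCLM t F) := by
  rw [contDiff_infty]
  intro n
  induction n generalizing F with
  | zero => exact_mod_cast contDiff_zero.2 (hl.continuous_expCLM T F)
  | succ n ih =>
    rw [Nat.cast_succ, contDiff_succ_iff_deriv]
    refine ⟨fun t => (hl.hasDerivAt_expCLM T F t).differentiableAt, by simp, ?_⟩
    have : deriv (fun t => T (hl.expCLM t F)) = fun t => -Complex.I *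
        T (hl.expCLM t (hl.ofReal.mulCLM F)) := funext fun t => (hl.hasDerivAt_expCLM T F t).deriv
    rw [this]
    exact contDiff_const.mul (ih _)

end LightCone

end

noncomputable section

namespace LightCone

variable {k : ℕ}

/-! ### The Fourier transform of tame test functions -/

theorem lineDerivOp_fourierVia (K : Space k ≃L[ℝ] Space k) (v : Space k) (h : 𝓢(Space k, ℂ)) :
    ∂_{v} (fourierVia K h) =
      fourierVia K (Complex.I • SchwartzMap.smulLeftCLM ℂ (fun p => inner ℝ p (K v)) h) := by
  set A : Space k ≃L[ℝ] Space k := K.trans (ContinuousLinearEquiv.smulLeft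
    (Units.mk0 (-(2 * Real.pi)⁻¹ : ℝ) (by simp [Real.pi_ne_zero]))) with hA
  have hvia : ∀ f : 𝓢(Space k, ℂ), fourierVia K f =
      SchwartzMap.compCLMOfContinuousLinearEquiv ℂ A (𝓕 f) := fun f => rfl
  have hAv : A v = (-(2 * Real.pi)⁻¹ : ℝ) • K v := rfl
  rw [hvia, hvia, SchwartzMap.lineDerivOp_compCLMOfContinuousLinearEquiv,
    SchwartzMap.lineDerivOp_fourier_eq]
  congr 2
  ext p
  have h1 : (fun p : Space k => inner ℝ p (A v)).HasTemperateGrowth := by fun_prop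
  have h2 : (fun p : Space k => inner ℝ p (K v)).HasTemperateGrowth := by fun_prop
  rw [smul_apply, smul_apply, SchwartzMap.smulLeftCLM_apply_apply h1,
    SchwartzMap.smulLeftCLM_apply_apply h2, hAv, inner_smul_right]
  simp only [Complex.real_smul, smul_eq_mul]
  have : (Real.pi : ℂ) ≠ 0 := by exact_mod_cast Real.pi_ne_zero
  push_cast
  field_simp

theorem inner_single_zero (p : Space (k + 1)) :
    inner ℝ p (EuclideanSpace.single 0 1 : Space (k + 1)) = p 0 := by
  rw [EuclideanSpace.inner_single_right]
  simp

/-- The Fourier transform of a tame test function is divisible by every power of `p⁺`. -/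
theorem exists_symm_fourierVia_eq_pow_mul {K : Space (k + 1) ≃L[ℝ] Space (k + 1)}
    (hK : K (EuclideanSpace.single (Fin.last k) 1) = EuclideanSpace.single 0 1)
    (g : tameSchwartz k) (r : ℕ) : ∃ h : 𝓢(Space (k + 1), ℂ), ∀ p,
      (fourierVia K).symm (g : 𝓢(Space (k + 1), ℂ)) p = (p 0 : ℂ) ^ r * h p := by
  have key : ∀ (r : ℕ) (g : 𝓢(Space (k + 1), ℂ)), ∃ h : 𝓢(Space (k + 1), ℂ), ∀ p,
      (fourierVia K).symm (((LineDeriv.lineDerivOpCLM ℂ 𝓢(Space (k + 1), ℂ)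
      (EuclideanSpace.single (Fin.last k) 1 : Space (k + 1))).toLinearMap ^ r) g) p
      = (p 0 : ℂ) ^ r * h p := by
    intro r
    induction r with
    | zero => exact fun g => ⟨(fourierVia K).symm g, fun p => by simp⟩
    | succ r ih =>
      intro g
      obtain ⟨h, hh⟩ := ih g
      -- Each ∂₋ contributes a factor i p⁺ on the Fourier side, since K maps the x⁻ direction to the
      -- p⁺ direction.
      refine ⟨Complex.I • h, fun p => ?_⟩
      set G := ((LineDeriv.lineDerivOpCLM ℂ 𝓢(Space (k + 1), ℂ)
        (EuclideanSpace.single (Fin.last k) 1 : Space (k + 1))).toLinearMap ^ r) g with hG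
      have e : ((LineDeriv.lineDerivOpCLM ℂ 𝓢(Space (k + 1), ℂ)
          (EuclideanSpace.single (Fin.last k) 1 : Space (k + 1))).toLinearMap ^ (r + 1)) g
          = ∂_{(EuclideanSpace.single (Fin.last k) 1 : Space (k + 1))}
            (fourierVia K ((fourierVia K).symm G)) := by
        rw [pow_succ', ContinuousLinearEquiv.apply_symm_apply]
        rfl
      have ht : (fun p : Space (k + 1) => inner ℝ p
        (EuclideanSpace.single 0 1 : Space (k + 1))).HasTemperateGrowth := by fun_prop
      rw [e, lineDerivOp_fourierVia, ContinuousLinearEquiv.symm_apply_apply, hK, smul_apply,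
        SchwartzMap.smulLeftCLM_apply_apply ht, hh, smul_apply, inner_single_zero]
      simp only [Complex.real_smul, smul_eq_mul]
      ring
  obtain ⟨g', hg'⟩ := (Submodule.mem_iInf _).1 g.2 r
  obtain ⟨h, hh⟩ := key r g'
  exact ⟨h, fun p => by rw [← hg', hh]⟩

/-- One derivative of (p⁺)^{r+1}G' is (p⁺)^r times a smooth function with values in linear maps, so
the induction runs over all target spaces. -/
theorem iteratedFDeriv_pow_smul_eq_zero (j : ℕ) : ∀ {V : Type} [NormedAddCommGroup V]
    [NormedSpace ℝ V] {G G' : Space (k + 1) → V} {r : ℕ}, j < r → ContDiff ℝ ∞ G' →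
    (∀ p, G p = (p 0) ^ r • G' p) → ∀ p, p 0 = 0 → iteratedFDeriv ℝ j G p = 0 := by
  induction j with
  | zero =>
    intro V _ _ G G' r hr _ hG p hp
    rw [← norm_eq_zero, norm_iteratedFDeriv_zero, hG, hp, zero_pow (by omega), zero_smul, norm_zero]
  | succ j ih =>
    intro V _ _ G G' r hr hG' hG p hp
    rw [← norm_eq_zero, ← norm_iteratedFDeriv_fderiv, norm_eq_zero]
    obtain ⟨r, rfl⟩ : ∃ r', r = r' + 1 := ⟨r - 1, by omega⟩
    have hd : ∀ p, HasFDerivAt G ((p 0) ^ r • (((r + 1 : ℕ) : ℝ) •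
        ((EuclideanSpace.proj 0 : Space (k + 1) →L[ℝ] ℝ).smulRight (G' p)) +
        (p 0) • fderiv ℝ G' p)) p := by
      intro p
      have h1 : HasFDerivAt (fun p : Space (k + 1) => (p 0) ^ (r + 1))
          (((r + 1 : ℕ) * (p 0) ^ r) • (EuclideanSpace.proj 0 : Space (k + 1) →L[ℝ] ℝ)) p := by
        have := ((EuclideanSpace.proj 0 : Space (k + 1) →L[ℝ] ℝ).hasFDerivAt (x := p)).pow (r + 1)
        simpa using this
      have h2 := h1.smul ((hG'.differentiable (by simp)) p).hasFDerivAt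
      rw [show G = fun p => (p 0) ^ (r + 1) • G' p from funext hG]
      refine h2.congr_fderiv ?_
      ext v
      simp only [add_apply, smul_apply, ContinuousLinearMap.smulRight_apply, smul_smul, smul_add,
        smul_eq_mul]
      rw [add_comm, pow_succ]
      congr 2
      ring
    refine ih (r := r) (G' := fun p => ((r + 1 : ℕ) : ℝ) •
        ((EuclideanSpace.proj 0 : Space (k + 1) →L[ℝ] ℝ).smulRight (G' p)) +
        (p 0) • fderiv ℝ G' p) (by omega) ?_ (fun p => (hd p).fderiv) p hp
    refine ContDiff.add (ContDiff.const_smul _ ?_) (ContDiff.smul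
      (EuclideanSpace.proj 0 : Space (k + 1) →L[ℝ] ℝ).contDiff (hG'.fderiv_right (by simp)))
    exact ((ContinuousLinearMap.smulRightL ℝ (Space (k + 1)) V
      (EuclideanSpace.proj 0 : Space (k + 1) →L[ℝ] ℝ)).contDiff).comp hG'

/-- Taylor's bound for a function all of whose derivatives vanish on the hyperplane `p⁺ = 0`. -/
theorem norm_iteratedFDeriv_le_of_flat {h : Space (k + 1) → ℂ} (hh : ContDiff ℝ ∞ h)
    (h0 : ∀ j p, p 0 = 0 → iteratedFDeriv ℝ j h p = 0) (m : ℕ) :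
    ∀ (j : ℕ) (p : Space (k + 1)) (B : ℝ),
      (∀ q, perp q = perp p → ‖iteratedFDeriv ℝ (j + m) h q‖ ≤ B) →
      ‖iteratedFDeriv ℝ j h p‖ ≤ |p 0| ^ m * B := by
  induction m with
  | zero =>
    intro j p B hB
    simpa using hB p rfl
  | succ m ih =>
    intro j p B hB
    have hB0 : 0 ≤ B := (norm_nonneg _).trans (hB p rfl)
    set s : Set (Space (k + 1)) := {q | perp q = perp p ∧ |q 0| ≤ |p 0|} with hs
    have hconv : Convex ℝ s := by
      intro x hx y hy a b ha hb hab
      refine ⟨?_, ?_⟩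
      · have e : perp (a • x + b • y) = a • perp x + b • perp y := rfl
        rw [e, hx.1, hy.1, ← add_smul, hab, one_smul]
      · change |a * x 0 + b * y 0| ≤ _
        calc |a * x 0 + b * y 0| ≤ a * |x 0| + b * |y 0| := by
              refine (abs_add_le _ _).trans (le_of_eq ?_)
              rw [abs_mul, abs_mul, abs_of_nonneg ha, abs_of_nonneg hb]
          _ ≤ a * |p 0| + b * |p 0| := 
              add_le_add (mul_le_mul_of_nonneg_left hx.2 ha) (mul_le_mul_of_nonneg_left hy.2 hb)
          _ = |p 0| := by rw [← add_mul, hab, one_mul]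
    -- The projection of p to the hyperplane, where the derivatives vanish. The mean value
    -- inequality between it and p, at distance |p⁺|, gains one power of |p⁺|.
    set p' : Space (k + 1) := p - EuclideanSpace.single 0 (p 0) with hp'
    have hp'0 : p' 0 = 0 := by simp [hp']
    have hp's : p' ∈ s := by
      refine ⟨?_, by rw [hp'0, abs_zero]; exact abs_nonneg _⟩
      ext i
      simp [perp, hp']
    have hmv := hconv.norm_image_sub_le_of_norm_fderiv_le (𝕜 := ℝ) (f := iteratedFDeriv ℝ j h)
      (C := |p 0| ^ m * B) (x := p') (y := p)
      (fun q _ => hh.differentiable_iteratedFDeriv (by exact_mod_cast ENat.natCast_lt_top j) q)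
      (fun q hq => by
        rw [norm_fderiv_iteratedFDeriv]
        refine (ih (j + 1) q B fun q' hq' => ?_).trans ?_
        · rw [show j + 1 + m = j + (m + 1) by ring]
          exact hB q' (hq'.trans hq.1)
        · exact mul_le_mul_of_nonneg_right (pow_le_pow_left₀ (abs_nonneg _) hq.2 m) hB0)
      hp's ⟨rfl, le_rfl⟩
    rw [h0 j p' hp'0, sub_zero] at hmv
    refine hmv.trans (le_of_eq ?_)
    have : p - p' = EuclideanSpace.single 0 (p 0) := by simp [hp']
    rw [this, PiLp.norm_single, Real.norm_eq_abs, pow_succ]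
    ring

/-- Divisibility by all powers of p⁺ makes the transform flat at p⁺ = 0. Taylor's bound then trades
each factor |p⁺|⁻¹ for one more derivative, so ordinary Schwartz seminorms suffice for continuity.
-/
theorem exists_tameFourier {K : Space (k + 1) ≃L[ℝ] Space (k + 1)}
    (hK : K (EuclideanSpace.single (Fin.last k) 1) = EuclideanSpace.single 0 1) :
    ∃ A : tameSchwartz k →L[ℂ] SqueezedSchwartz k, ∀ (g : tameSchwartz k) p, p 0 ≠ 0 →
      A g p = (fourierVia K).symm (g : 𝓢(Space (k + 1), ℂ)) p := by
  have hflat : ∀ (g : tameSchwartz k) (j : ℕ) (p : Space (k + 1)), p 0 = 0 →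
      iteratedFDeriv ℝ j ((fourierVia K).symm (g : 𝓢(Space (k + 1), ℂ))) p = 0 := by
    intro g j p hp
    obtain ⟨h, hh⟩ := exists_symm_fourierVia_eq_pow_mul hK g (j + 1)
    refine iteratedFDeriv_pow_smul_eq_zero j (G' := h) (r := j + 1) (by omega) (h.smooth ⊤)
      (fun q => ?_) p hp
    rw [hh q, Complex.real_smul, Complex.ofReal_pow]
  refine SqueezedSchwartz.exists_clm (V := tameSchwartz k)
    (fun g p => (fourierVia K).symm (g : 𝓢(Space (k + 1), ℂ)) p)
    (fun f g p _ => by rw [Submodule.coe_add, map_add, add_apply])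
    (fun c f p _ => by rw [Submodule.coe_smul, map_smul, smul_apply, smul_eq_mul])
    (fun g => (((fourierVia K).symm (g : 𝓢(Space (k + 1), ℂ))).smooth ⊤).contDiffOn) fun N n => ?_
  let S : ℕ → ℕ → Seminorm ℂ (tameSchwartz k) := fun a b =>
    (SchwartzMap.seminorm ℂ a b).comp
      (((fourierVia K).symm : 𝓢(Space (k + 1), ℂ) →ₗ[ℂ] 𝓢(Space (k + 1), ℂ)) ∘ₗ
        (tameSchwartz k).subtype)
  have hS : ∀ a b, Continuous (S a b) := fun a b =>
    ((schwartz_withSeminorms ℂ (Space (k + 1)) ℂ).continuous_seminorm (a, b)).comp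
      ((fourierVia K).symm.continuous.comp continuous_subtype_val)
  -- One seminorm for each term of `weight_pow_le`; the order n + N pays for |p⁺|⁻ᴺ.
  refine ⟨(4 ^ N : NNReal) • (S 0 n + S N n + S 0 (n + N) + S N n), ?_, fun g p hp => ?_⟩
  · exact ((((hS 0 n).add (hS N n)).add (hS 0 (n + N))).add (hS N n)).const_smul (4 ^ N : NNReal)
  · set h := (fourierVia K).symm (g : 𝓢(Space (k + 1), ℂ)) with hh
    change _ ≤ 4 ^ N * (SchwartzMap.seminorm ℂ 0 n h + SchwartzMap.seminorm ℂ N n h +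
      SchwartzMap.seminorm ℂ 0 (n + N) h + SchwartzMap.seminorm ℂ N n h)
    refine (mul_le_mul_of_nonneg_right (weight_pow_le p N) (norm_nonneg _)).trans ?_
    rw [mul_assoc]
    refine mul_le_mul_of_nonneg_left ?_ (by positivity)
    have h1 : ‖iteratedFDeriv ℝ n h p‖ ≤ SchwartzMap.seminorm ℂ 0 n h :=
      SchwartzMap.norm_iteratedFDeriv_le_seminorm ℂ h n p
    have h2 : |p 0| ^ (N : ℤ) * ‖iteratedFDeriv ℝ n h p‖ ≤ SchwartzMap.seminorm ℂ N n h := by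
      refine le_trans ?_ (SchwartzMap.le_seminorm ℂ N n h p)
      rw [zpow_natCast]
      gcongr
      exact abs_coord_le p 0
    have h3 : |p 0| ^ (-N : ℤ) * ‖iteratedFDeriv ℝ n h p‖ ≤
        SchwartzMap.seminorm ℂ 0 (n + N) h := by
      have hp0 : 0 < |p 0| := abs_pos.2 hp
      have := norm_iteratedFDeriv_le_of_flat (h.smooth ⊤) (hflat g) N n p _
        fun q _ => SchwartzMap.norm_iteratedFDeriv_le_seminorm ℂ h (n + N) q
      rw [zpow_neg, zpow_natCast, inv_mul_le_iff₀ (by positivity)]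
      exact this
    have h4 : ‖perp p‖ ^ N * ‖iteratedFDeriv ℝ n h p‖ ≤ SchwartzMap.seminorm ℂ N n h := by
      refine le_trans ?_ (SchwartzMap.le_seminorm ℂ N n h p)
      gcongr
      exact norm_perp_le p
    rw [add_mul, add_mul, add_mul, one_mul]
    linarith

/-! ### Squeezed Schwartz functions as Schwartz functions -/

theorem SqueezedSchwartz.exists_toSchwartz : ∃ A : SqueezedSchwartz k →L[ℂ] 𝓢(Space (k + 1), ℂ),
    ∀ (f : SqueezedSchwartz k) p, A f p = f p := by
  choose q hq hq' using SqueezedSchwartz.exists_seminorm (k := k)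
  have hb : ∀ (N n : ℕ) (f : SqueezedSchwartz k) (p : Space (k + 1)),
      ‖p‖ ^ N * ‖iteratedFDeriv ℝ n (f : Space (k + 1) → ℂ) p‖ ≤ q N n f := by
    intro N n f p
    have hcont : Continuous fun p =>
        ‖p‖ ^ N * ‖iteratedFDeriv ℝ n (f : Space (k + 1) → ℂ) p‖ :=
      (continuous_norm.pow N).mul
        (f.2.1.continuous_iteratedFDeriv (by exact_mod_cast le_top)).norm
    have hcl : IsClosed {p | ‖p‖ ^ N * ‖iteratedFDeriv ℝ n (f : Space (k + 1) → ℂ) p‖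
      ≤ q N n f} := isClosed_le hcont continuous_const
    refine hcl.closure_subset_iff.2 (fun p hp => ?_) (dense_offPlane k p)
    refine le_trans ?_ (hq' N n f n le_rfl p hp)
    gcongr
    linarith [one_add_norm_le_weight p]
  let A : SqueezedSchwartz k →ₗ[ℂ] 𝓢(Space (k + 1), ℂ) :=
    { toFun := fun f => ⟨f, f.2.1, fun N n => ⟨q N n f, hb N n f⟩⟩
      map_add' := fun f g => rfl
      map_smul' := fun c f => rfl }
  refine ⟨⟨A, ?_⟩, fun f p => rfl⟩
  refine (schwartz_withSeminorms ℂ (Space (k + 1)) ℂ).continuous_of_continuous_comp A fun i => ?_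
  exact Seminorm.continuous_of_le (hq i.1 i.2) fun f =>
    SchwartzMap.seminorm_le_bound ℂ i.1 i.2 (A f) (apply_nonneg _ f) (hb i.1 i.2 f)

end LightCone

end

noncomputable section

namespace LightCone

/-! ### Tensor products of Schwartz functions -/

section Tensor

variable {V : Type*} [NormedAddCommGroup V] [NormedSpace ℝ V]
  {W : Type*} [NormedAddCommGroup W] [NormedSpace ℝ W]

theorem norm_iteratedFDeriv_comp_clm_le {G : Type*} [NormedAddCommGroup G] [NormedSpace ℝ G]
    {g : W → G} (hg : ContDiff ℝ ∞ g) (π : V →L[ℝ] W) (hπ : ‖π‖ ≤ 1) (i : ℕ) (v : V) :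
    ‖iteratedFDeriv ℝ i (fun v => g (π v)) v‖ ≤ ‖iteratedFDeriv ℝ i g (π v)‖ := by
  have := π.iteratedFDeriv_comp_right hg v (i := i) (by exact_mod_cast le_top)
  rw [show (fun v => g (π v)) = g ∘ π from rfl, this]
  refine (ContinuousMultilinearMap.norm_compContinuousLinearMap_le _ _).trans ?_
  refine mul_le_of_le_one_right (norm_nonneg _) ?_
  rw [Finset.prod_const]
  exact pow_le_one₀ (norm_nonneg _) hπ

/-- Since ‖v‖ ≤ (1 + |l v|)(1 + ‖π v‖), polynomial weights in v split between the two factors. -/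
theorem exists_schwartz_tensor (l : V →L[ℝ] ℝ) (π : V →L[ℝ] W) (hl : ‖l‖ ≤ 1) (hπ : ‖π‖ ≤ 1)
    (h : ∀ v, ‖v‖ ≤ |l v| + ‖π v‖) (f : 𝓢(ℝ, ℂ)) (g : 𝓢(W, ℂ)) :
    ∃ S : 𝓢(V, ℂ), ∀ v, S v = f (l v) * g (π v) := by
  have hf : ContDiff ℝ ∞ (fun v => f (l v)) := (f.smooth ⊤).comp l.contDiff
  have hg : ContDiff ℝ ∞ (fun v => g (π v)) := (g.smooth ⊤).comp π.contDiff
  refine ⟨⟨fun v => f (l v) * g (π v), hf.mul hg, fun N n => ?_⟩, fun v => rfl⟩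
  set A := 2 ^ N * (Finset.Iic (N, n)).sup (fun m => SchwartzMap.seminorm ℝ m.1 m.2) f with hA
  set B := 2 ^ N * (Finset.Iic (N, n)).sup (fun m => SchwartzMap.seminorm ℝ m.1 m.2) g with hB
  refine ⟨2 ^ n * A * B, fun v => ?_⟩
  have h1 : 0 < 1 + |l v| := by positivity
  have h2 : 0 < 1 + ‖π v‖ := by positivity
  have hb := norm_iteratedFDeriv_mul_le_two_pow isOpen_univ hf.contDiffOn hg.contDiffOn
    (Set.mem_univ v) (n := n) (a := A / (1 + |l v|) ^ N) (b := B / (1 + ‖π v‖) ^ N)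
    (fun i hi => by
      rw [le_div_iff₀' (by positivity)]
      refine le_trans ?_ (SchwartzMap.one_add_le_sup_seminorm_apply (𝕜 := ℝ) (m := (N, n)) le_rfl
        hi f (l v))
      exact mul_le_mul_of_nonneg_left
        (norm_iteratedFDeriv_comp_clm_le (f.smooth ⊤) l hl i v) (by positivity))
    (fun i hi => by
      rw [le_div_iff₀' (by positivity)]
      refine le_trans ?_ (SchwartzMap.one_add_le_sup_seminorm_apply (𝕜 := ℝ) (m := (N, n)) le_rfl
        hi g (π v))
      exact mul_le_mul_of_nonneg_left
        (norm_iteratedFDeriv_comp_clm_le (g.smooth ⊤) π hπ i v) (by positivity))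
  have hv : ‖v‖ ≤ (1 + |l v|) * (1 + ‖π v‖) := by
    have := h v
    nlinarith [mul_nonneg (abs_nonneg (l v)) (norm_nonneg (π v))]
  calc _ ≤ ((1 + |l v|) * (1 + ‖π v‖)) ^ N *
        (2 ^ n * (A / (1 + |l v|) ^ N) * (B / (1 + ‖π v‖) ^ N)) := by gcongr
    _ = _ := by rw [mul_pow]; field_simp

end Tensor

/-! ### Splitting off a coordinate -/

variable {d : ℕ}

/-- The spatial part of a momentum `(p⁺, p_⊥, p⁻)`, namely `(p⁺, p_⊥)`. -/
def momentum (p : Space (d + 2)) : Space (d + 1) := WithLp.toLp 2 fun i => p i.castSucc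

/-- `momentum` as a continuous linear map. -/
def momentumCLM (d : ℕ) : Space (d + 2) →L[ℝ] Space (d + 1) :=
  LinearMap.toContinuousLinearMap
    { toFun := momentum, map_add' := fun _ _ => rfl, map_smul' := fun _ _ => rfl }

/-- `spatial` as a continuous linear map. -/
def spatialCLM (d : ℕ) : Space (d + 2) →L[ℝ] Space (d + 1) :=
  LinearMap.toContinuousLinearMap
    { toFun := spatial, map_add' := fun _ _ => rfl, map_smul' := fun _ _ => rfl }

theorem momentum_zero (p : Space (d + 2)) : momentum p 0 = p 0 := rfl

theorem norm_sq_eq_add_momentum (p : Space (d + 2)) :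
    ‖p‖ ^ 2 = (p (Fin.last (d + 1))) ^ 2 + ‖momentum p‖ ^ 2 := by
  rw [EuclideanSpace.real_norm_sq_eq, EuclideanSpace.real_norm_sq_eq, Fin.sum_univ_castSucc,
    add_comm]
  rfl

theorem norm_momentum_le (p : Space (d + 2)) : ‖momentum p‖ ≤ ‖p‖ := by
  refine (sq_le_sq₀ (norm_nonneg _) (norm_nonneg _)).1 ?_
  rw [norm_sq_eq_add_momentum p]
  nlinarith [sq_nonneg (p (Fin.last (d + 1)))]

theorem norm_le_abs_add_norm_momentum (p : Space (d + 2)) :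
    ‖p‖ ≤ |p (Fin.last (d + 1))| + ‖momentum p‖ := by
  refine (sq_le_sq₀ (norm_nonneg _) (by positivity)).1 ?_
  rw [norm_sq_eq_add_momentum p, ← sq_abs (p (Fin.last (d + 1)))]
  nlinarith [mul_nonneg (abs_nonneg (p (Fin.last (d + 1)))) (norm_nonneg (momentum p))]

theorem norm_spatial_le (x : Space (d + 2)) : ‖spatial x‖ ≤ ‖x‖ := norm_perp_le x

theorem norm_le_abs_add_norm_spatial (x : Space (d + 2)) : ‖x‖ ≤ |x 0| + ‖spatial x‖ :=
  norm_le_abs_add_norm_perp x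

theorem norm_proj_le_one {k : ℕ} (i : Fin (k + 1)) :
    ‖(EuclideanSpace.proj i : Space (k + 1) →L[ℝ] ℝ)‖ ≤ 1 :=
  ContinuousLinearMap.opNorm_le_bound _ zero_le_one fun p => by
    rw [one_mul]; exact abs_coord_le p i

theorem norm_momentumCLM_le : ‖momentumCLM d‖ ≤ 1 :=
  ContinuousLinearMap.opNorm_le_bound _ zero_le_one fun p => by
    rw [one_mul]; exact norm_momentum_le p

theorem norm_spatialCLM_le : ‖spatialCLM d‖ ≤ 1 :=
  ContinuousLinearMap.opNorm_le_bound _ zero_le_one fun p => by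
    rw [one_mul]; exact norm_spatial_le p

theorem exists_tensor_spatial (f : 𝓢(ℝ, ℂ)) (g : 𝓢(Space (d + 1), ℂ)) :
    ∃ S : 𝓢(Space (d + 2), ℂ), ∀ x, S x = f (x 0) * g (spatial x) := by
  obtain ⟨S, hS⟩ := exists_schwartz_tensor (EuclideanSpace.proj 0 : Space (d + 2) →L[ℝ] ℝ)
    (spatialCLM d) (norm_proj_le_one (k := d + 1) 0) norm_spatialCLM_le
    (fun x => norm_le_abs_add_norm_spatial x) f g
  exact ⟨S, fun x => hS x⟩

theorem exists_tensor_momentum (f : 𝓢(ℝ, ℂ)) (g : 𝓢(Space (d + 1), ℂ)) :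
    ∃ S : 𝓢(Space (d + 2), ℂ), ∀ p, S p = f (p (Fin.last (d + 1))) * g (momentum p) :=
  exists_schwartz_tensor (EuclideanSpace.proj (Fin.last (d + 1))) (momentumCLM d)
    (norm_proj_le_one _) norm_momentumCLM_le norm_le_abs_add_norm_momentum f g

theorem lineDerivOp_tensor {f : ℝ → ℂ} {g : 𝓢(Space (d + 1), ℂ)} {S S' : 𝓢(Space (d + 2), ℂ)}
    (hS : ∀ x, S x = f (x 0) * g (spatial x))
    (hS' : ∀ x, S' x = f (x 0) *
      (∂_{(EuclideanSpace.single (Fin.last d) 1 : Space (d + 1))} g) (spatial x)) :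
    ∂_{(EuclideanSpace.single (Fin.last (d + 1)) 1 : Space (d + 2))} S = S' := by
  ext x
  rw [hS', SchwartzMap.lineDerivOp_apply, SchwartzMap.lineDerivOp_apply, lineDeriv, lineDeriv,
    ← deriv_const_mul_field]
  congr 1
  funext t
  rw [hS]
  have h1 : (x + t • (EuclideanSpace.single (Fin.last (d + 1)) 1 : Space (d + 2))) 0 = x 0 := by
    simp [Fin.ext_iff]
  have h2 : spatial (x + t • (EuclideanSpace.single (Fin.last (d + 1)) 1 : Space (d + 2)))
      = spatial x + t • (EuclideanSpace.single (Fin.last d) 1 : Space (d + 1)) := by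
    ext i
    simp [spatial, ← Fin.succ_last]
  rw [h1, h2]

/-- The element `f(x⁺) ⊗ g` of `𝓢_{∂₋}(ℝ^{1+n})`. -/
theorem exists_tame_tensor (f : 𝓢(ℝ, ℂ)) (g : tameSchwartz d) :
    ∃ φ : tameSchwartz (d + 1), ∀ x : Space (d + 2), (φ : 𝓢(Space (d + 2), ℂ)) x
      = f (x 0) * (g : 𝓢(Space (d + 1), ℂ)) (spatial x) := by
  obtain ⟨S, hS⟩ := exists_tensor_spatial f (g : 𝓢(Space (d + 1), ℂ))
  refine ⟨⟨S, (Submodule.mem_iInf _).2 fun r => ?_⟩, hS⟩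
  obtain ⟨g', hg'⟩ := (Submodule.mem_iInf _).1 g.2 r
  -- With g = ∂₋ʳ g', the derivative passes through the factor f(x⁺), and f ⊗ g = ∂₋ʳ(f ⊗ g').
  rw [← hg'] at hS
  clear hg'
  induction r generalizing S with
  | zero => exact ⟨S, rfl⟩
  | succ r ih =>
    obtain ⟨S', hS'⟩ := exists_tensor_spatial f (((LineDeriv.lineDerivOpCLM ℂ 𝓢(Space (d + 1), ℂ)
      (EuclideanSpace.single (Fin.last d) 1 : Space (d + 1))).toLinearMap ^ r) g')
    obtain ⟨S'', hS''⟩ := ih S' hS'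
    refine ⟨S'', ?_⟩
    rw [pow_succ', Module.End.mul_apply, hS'']
    refine lineDerivOp_tensor hS' fun x => ?_
    rw [hS x, pow_succ', Module.End.mul_apply]
    rfl

/-! ### The Fourier transform of a tensor product -/

theorem lcForm_eq (p x : Space (d + 2)) : lcForm p x =
    p (Fin.last (d + 1)) * x 0 + lcSpatialForm (spatial x) (momentum p) := by
  have h1 : spatial x (Fin.last d) = x (Fin.last (d + 1)) := by simp [spatial]
  have h2 : ∀ i : Fin d, spatial x i.castSucc = x i.succ.castSucc := fun i => by simp [spatial]
  have h3 : ∀ i : Fin d, momentum p i.succ = p i.succ.castSucc := fun i => rfl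
  simp only [lcForm, lcSpatialForm, h1, h2, h3, momentum_zero, mul_comm]
  ring

theorem integral_tensor_momentum (F : ℝ → ℂ) (G : Space (d + 1) → ℂ) :
    ∫ p : Space (d + 2), F (p (Fin.last (d + 1))) * G (momentum p)
      = (∫ a, F a) * ∫ q, G q := by
  rw [← integral_prod_mul, ← Measure.volume_eq_prod]
  let e1 := (MeasurableEquiv.toLp 2 (Fin (d + 2) → ℝ)).symm
  let e2 := MeasurableEquiv.piFinSuccAbove (fun _ : Fin (d + 2) => ℝ) (Fin.last (d + 1))
  let e3 := (MeasurableEquiv.refl ℝ).prodCongr (MeasurableEquiv.toLp 2 (Fin (d + 1) → ℝ))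
  have h1 : MeasurePreserving e1 := EuclideanSpace.volume_preserving_symm_measurableEquiv_toLp _
  have h2 : MeasurePreserving e2 := volume_preserving_piFinSuccAbove _ _
  have h3 : MeasurePreserving e3 := by
    exact (MeasurePreserving.id (volume : Measure ℝ)).prod
      (PiLp.volume_preserving_toLp (Fin (d + 1)))
  have h := (h3.comp (h2.comp h1)).integral_comp
    ((e1.trans e2).trans e3).measurableEmbedding (fun z : ℝ × Space (d + 1) => F z.1 * G z.2)
  rw [← h]
  refine integral_congr_ae (Filter.Eventually.of_forall fun p => ?_)
  have : (e3 ∘ e2 ∘ e1) p = (p (Fin.last (d + 1)), momentum p) := by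
    simp only [Function.comp_apply, e1, e2, e3]
    refine Prod.ext rfl ?_
    ext i
    simp [MeasurableEquiv.piFinSuccAbove, momentum, MeasurableEquiv.prodCongr, Fin.init]
  change _ = F ((e3 ∘ e2 ∘ e1) p).1 * G ((e3 ∘ e2 ∘ e1) p).2
  rw [this]

/-- Rescaling the frequency by 2π removes the 2π from the exponent and puts it in front of the
inversion formula. -/
theorem exists_schwartz_fourier (f : 𝓢(ℝ, ℂ)) : ∃ φ : 𝓢(ℝ, ℂ),
    (∀ a : ℝ, φ a = ∫ t : ℝ, f t * Complex.exp (-Complex.I * a * t)) ∧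
    ∀ x : ℝ, ∫ a : ℝ, φ a * Complex.exp (Complex.I * (a * x : ℝ)) = 2 * Real.pi * f x := by
  have hpi : (2 * Real.pi : ℝ) ≠ 0 := by positivity
  have hpi' : (Real.pi : ℂ) ≠ 0 := by exact_mod_cast Real.pi_ne_zero
  set e : ℝ ≃L[ℝ] ℝ := ContinuousLinearEquiv.smulLeft (Units.mk0 ((2 * Real.pi)⁻¹ : ℝ)
    (inv_ne_zero hpi)) with he
  have hap : ∀ a, SchwartzMap.compCLMOfContinuousLinearEquiv ℂ e (𝓕 f) a
      = 𝓕 f (a / (2 * Real.pi)) := fun a => by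
    change 𝓕 f ((2 * Real.pi)⁻¹ * a) = _
    rw [inv_mul_eq_div]
  refine ⟨SchwartzMap.compCLMOfContinuousLinearEquiv ℂ e (𝓕 f), fun a => ?_, fun x => ?_⟩
  · rw [hap, SchwartzMap.fourier_coe, Real.fourier_real_eq_integral_exp_smul]
    refine integral_congr_ae (Filter.Eventually.of_forall fun t => ?_)
    simp only [smul_eq_mul]
    rw [mul_comm]
    congr 2
    push_cast
    field_simp
  · have h1 : ∀ a : ℝ, SchwartzMap.compCLMOfContinuousLinearEquiv ℂ e (𝓕 f) a *
        Complex.exp (Complex.I * (a * x : ℝ)) = (fun s : ℝ => 𝓕 f s *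
          Complex.exp (Complex.I * (2 * Real.pi * s * x : ℝ))) (a / (2 * Real.pi)) := by
      intro a
      simp only [hap]
      congr 3
      push_cast
      field_simp
    simp_rw [h1]
    rw [Measure.integral_comp_div (fun s : ℝ => 𝓕 f s *
          Complex.exp (Complex.I * (2 * Real.pi * s * x : ℝ))), abs_of_pos (by positivity),
      Complex.real_smul]
    have h2 : ∫ s : ℝ, 𝓕 f s * Complex.exp (Complex.I * (2 * Real.pi * s * x : ℝ)) = f x := by
      have h3 : 𝓕⁻ (𝓕 f) x = f x := by rw [FourierTransform.fourierInv_fourier_eq]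
      rw [← h3, SchwartzMap.fourierInv_coe, Real.fourierInv_eq']
      refine integral_congr_ae (Filter.Eventually.of_forall fun s => ?_)
      simp only [smul_eq_mul]
      rw [mul_comm]
      congr 2
      rw [show inner ℝ s x = s * x by simp [mul_comm], mul_comm]
      push_cast
      ring
    rw [h2]
    push_cast
    ring

/-- The pairing splits as p⁻x⁺ plus the spatial form, so Fubini factors the forward transform of the
right-hand side. One-dimensional inversion identifies it with S. -/
theorem lcFourier_symm_tensor (f : 𝓢(ℝ, ℂ)) (g : 𝓢(Space (d + 1), ℂ)) (S : 𝓢(Space (d + 2), ℂ))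
    (hS : ∀ x, S x = f (x 0) * g (spatial x)) (p : Space (d + 2)) :
    (lcFourier d).symm S p = (1 / (2 * Real.pi) : ℂ) *
      (∫ t : ℝ, f t * Complex.exp (-Complex.I * (p (Fin.last (d + 1)) : ℝ) * t)) *
        (lcSpatialFourier d).symm g (momentum p) := by
  obtain ⟨φ, hφ, hφ'⟩ := exists_schwartz_fourier f
  set h := (lcSpatialFourier d).symm g with hh
  obtain ⟨R, hR⟩ := exists_tensor_momentum φ h
  have hpi' : (Real.pi : ℂ) ≠ 0 := by exact_mod_cast Real.pi_ne_zero
  have key : lcFourier d ((1 / (2 * Real.pi) : ℂ) • R) = S := by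
    ext x
    rw [map_smul, smul_apply, lcFourier_apply, hS]
    have e : ∀ p, R p * Complex.exp (Complex.I * lcForm p x) =
        (fun a : ℝ => φ a * Complex.exp (Complex.I * (a * x 0 : ℝ))) (p (Fin.last (d + 1))) *
        (fun q : Space (d + 1) => h q * Complex.exp (Complex.I * lcSpatialForm (spatial x) q))
          (momentum p) := by
      intro p
      simp only [hR, lcForm_eq]
      rw [Complex.ofReal_add, mul_add, Complex.exp_add]
      ring
    rw [integral_congr_ae (Filter.Eventually.of_forall e), integral_tensor_momentum
      (fun a : ℝ => φ a * Complex.exp (Complex.I * (a * x 0 : ℝ)))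
      (fun q : Space (d + 1) => h q * Complex.exp (Complex.I * lcSpatialForm (spatial x) q)),
    hφ', ← lcSpatialFourier_apply, hh,
      ContinuousLinearEquiv.apply_symm_apply, smul_eq_mul]
    field_simp
  rw [← key, ContinuousLinearEquiv.symm_apply_apply, smul_apply, hR, hφ, smul_eq_mul]
  ring

end LightCone

end

noncomputable section

namespace LightCone

variable {d k : ℕ}

/-! ### The mass shell -/

theorem isMultiplier_energy {V : Type*} [NormedAddCommGroup V] [InnerProductSpace ℝ V]
    (L : Space (k + 1) →L[ℝ] V) (c : ℝ) :
    IsMultiplier (fun p : Space (k + 1) => (‖L p‖ ^ 2 + c) / (2 * p 0)) := by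
  have h1 : Function.HasTemperateGrowth (fun p : Space (k + 1) => ‖L p‖ ^ 2) :=
    (Function.hasTemperateGrowth_norm_sq V).comp L.hasTemperateGrowth
  refine (((IsMultiplier.of_temperate h1).add (.const c)).mul
    ((IsMultiplier.const (2⁻¹ : ℝ)).mul .inv_coord)).congr fun p _ => ?_
  rw [div_eq_mul_inv, mul_inv]

/-- `perp` as a continuous linear map. -/
def perpCLM (d : ℕ) : Space (d + 1) →L[ℝ] Space d :=
  LinearMap.toContinuousLinearMap
    { toFun := perp, map_add' := fun _ _ => rfl, map_smul' := fun _ _ => rfl }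

theorem isMultiplier_lcEnergy (m : ℝ) : IsMultiplier (lcEnergy m : Space (d + 1) → ℝ) :=
  isMultiplier_energy (perpCLM d) (m ^ 2)

theorem isMultiplier_lcEnergy_momentum (m : ℝ) :
    IsMultiplier (fun p : Space (d + 2) => lcEnergy m (momentum p)) :=
  isMultiplier_energy ((perpCLM d).comp (momentumCLM d)) (m ^ 2)

/-- The embedding `p ↦ (p, 0)` of the spatial momenta. -/
def snocZeroCLM (d : ℕ) : Space (d + 1) →L[ℝ] Space (d + 2) :=
  LinearMap.toContinuousLinearMap
    { toFun := fun p => WithLp.toLp 2 (Fin.snoc (fun i => p i) (0 : ℝ))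
      map_add' := fun p q => by
        ext i
        refine Fin.lastCases ?_ (fun j => ?_) i <;> simp
      map_smul' := fun c p => by
        ext i
        refine Fin.lastCases ?_ (fun j => ?_) i <;> simp }

theorem momentum_shellPoint (m : ℝ) (p : Space (d + 1)) : momentum (shellPoint m p) = p := by
  ext i
  simp [momentum, shellPoint]

theorem shellPoint_last (m : ℝ) (p : Space (d + 1)) :
    shellPoint m p (Fin.last (d + 1)) = lcEnergy m p := by
  simp [shellPoint]

theorem isMultiplier_shellPoint (m : ℝ) :
    IsMultiplier (shellPoint m : Space (d + 1) → Space (d + 2)) := by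
  have h := (isMultiplier_lcEnergy (d := d) m).comp (g := fun s : ℝ =>
    s • (EuclideanSpace.single (Fin.last (d + 1)) 1 : Space (d + 2)))
    (ContinuousLinearMap.toSpanSingleton ℝ _).hasTemperateGrowth
  refine ((IsMultiplier.of_temperate (snocZeroCLM d).hasTemperateGrowth).add h).congr fun p _ => ?_
  ext i
  change shellPoint m p i = (WithLp.toLp 2 (Fin.snoc (fun i => p i) (0 : ℝ)) : Space (d + 2)) i
    + (lcEnergy m p • (EuclideanSpace.single (Fin.last (d + 1)) 1 : Space (d + 2))) i
  refine Fin.lastCases ?_ (fun j => ?_) i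
  · simp [shellPoint]
  · simp [shellPoint, (Fin.castSucc_lt_last j).ne]

/-- The mass enters here: |ω̃| ≥ m²/(2|p⁺|), so small p⁺ means a large last coordinate on the shell.
-/
theorem weight_le_shellPoint {m : ℝ} (hm : 0 < m) {p : Space (d + 1)} (hp : p 0 ≠ 0) :
    weight p ≤ (3 + 2 / m ^ 2) * (1 + ‖shellPoint m p‖) := by
  set y := shellPoint m p with hy
  have h1 : ‖p‖ ≤ ‖y‖ := by
    have := norm_momentum_le y
    rwa [hy, momentum_shellPoint] at this
  have h2 := (abs_coord_le p 0).trans h1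
  have h3 := (norm_perp_le p).trans h1
  have h4 : |lcEnergy m p| ≤ ‖y‖ := by
    rw [← shellPoint_last]
    exact abs_coord_le _ _
  have hp0 : 0 < |p 0| := abs_pos.2 hp
  have h5 : |p 0|⁻¹ ≤ 2 / m ^ 2 * |lcEnergy m p| := by
    rw [lcEnergy, abs_div, abs_mul, abs_of_nonneg (by positivity : 0 ≤ ‖perp p‖ ^ 2 + m ^ 2),
      abs_of_pos (by norm_num : (0 : ℝ) < 2)]
    rw [div_mul_div_comm, inv_eq_one_div, div_le_div_iff₀ hp0 (by positivity)]
    nlinarith [mul_nonneg (sq_nonneg ‖perp p‖) hp0.le]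
  have h6 : 2 / m ^ 2 * |lcEnergy m p| ≤ 2 / m ^ 2 * ‖y‖ := by gcongr
  have h7 : 0 ≤ 2 / m ^ 2 := by positivity
  unfold weight
  nlinarith [norm_nonneg y]

theorem exists_comp_shellPoint {m : ℝ} (hm : 0 < m) :
    ∃ A : 𝓢(Space (d + 2), ℂ) →L[ℂ] SqueezedSchwartz d, ∀ f p, p 0 ≠ 0 →
      A f p = f (shellPoint m p) := by
  refine SqueezedSchwartz.exists_clm (V := 𝓢(Space (d + 2), ℂ)) (fun f p => f (shellPoint m p))
    (fun f g p _ => rfl) (fun c f p _ => rfl)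
    (fun f => (f.smooth ⊤).comp_contDiffOn (isMultiplier_shellPoint m).1) fun N n => ?_
  obtain ⟨M, D, hD, -, h⟩ := (isMultiplier_shellPoint (d := d) m).uniform_pow n
  -- N is the requested decay and M n the loss from differentiating the parametrization.
  set K := N + M * n with hK
  set c : ℝ := 3 + 2 / m ^ 2 with hc
  have hc0 : 0 < c := by positivity
  set q : Seminorm ℂ 𝓢(Space (d + 2), ℂ) :=
    (Finset.Iic (K, n)).sup (schwartzSeminormFamily ℂ (Space (d + 2)) ℂ) with hq
  have hqc : Continuous q := 
    (schwartz_withSeminorms ℂ (Space (d + 2)) ℂ).finset_sups.continuous_seminorm _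
  refine ⟨Real.toNNReal (n.factorial * c ^ K * 2 ^ K * D ^ n) • q, hqc.const_smul _,
    fun f p hp => ?_⟩
  have hy : 0 < 1 + ‖shellPoint m p‖ := by positivity
  have hw := weight_pos p
  have h1 := norm_iteratedFDeriv_comp_le_of_isOpen (isOpen_offPlane d) isOpen_univ
    (f.smooth ⊤).contDiffOn (isMultiplier_shellPoint m).1 (Set.mapsTo_univ _ _) hp (n := n)
    (C := 2 ^ K * q f / (1 + ‖shellPoint m p‖) ^ K) (fun i hi => by
      rw [le_div_iff₀' (by positivity)]
      exact SchwartzMap.one_add_le_sup_seminorm_apply (𝕜 := ℂ) (m := (K, n)) le_rfl hi f _)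
    (h p hp)
  have h2 : weight p ^ K ≤ c ^ K * (1 + ‖shellPoint m p‖) ^ K := by
    rw [← mul_pow]
    exact pow_le_pow_left₀ hw.le (weight_le_shellPoint hm hp) K
  have hq0 : 0 ≤ q f := apply_nonneg q f
  calc _ ≤ weight p ^ N * (n.factorial * (2 ^ K * q f / (1 + ‖shellPoint m p‖) ^ K) *
        (D * weight p ^ M) ^ n) := by gcongr
    _ = weight p ^ K * (n.factorial * 2 ^ K * D ^ n * (q f / (1 + ‖shellPoint m p‖) ^ K)) := by
        rw [hK, pow_add, pow_mul, mul_pow]; ring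
    _ ≤ c ^ K * (1 + ‖shellPoint m p‖) ^ K *
        (n.factorial * 2 ^ K * D ^ n * (q f / (1 + ‖shellPoint m p‖) ^ K)) := by gcongr
    _ = (n.factorial * c ^ K * 2 ^ K * D ^ n) * q f := by field_simp
    _ = _ := by
        change _ = (Real.toNNReal (n.factorial * c ^ K * 2 ^ K * D ^ n) : ℝ) * q f
        rw [Real.coe_toNNReal _ (by positivity)]

/-! ### Light-cone Fourier transforms of tame test functions -/

theorem lcSpatialFlip_single :
    lcSpatialFlip d (EuclideanSpace.single (Fin.last d) 1) = EuclideanSpace.single 0 1 := by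
  ext i
  refine Fin.cases ?_ (fun j => ?_) i
  · simp [lcSpatialFlip]
  · simp [lcSpatialFlip]

theorem lcFlip_single :
    lcFlip d (EuclideanSpace.single (Fin.last (d + 1)) 1) = EuclideanSpace.single 0 1 := by
  ext i
  refine Fin.cases ?_ (fun j => ?_) i
  · simp [lcFlip]
  · refine Fin.lastCases ?_ (fun l => ?_) j
    · simp [lcFlip]
    · simp [lcFlip, Fin.ext_iff]
      omega

/-- `𝓕_LC⁻¹` as a map from the tame test functions to the squeezed Schwartz space. -/
def tameSpatialFourier (d : ℕ) : tameSchwartz d →L[ℂ] SqueezedSchwartz d :=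
  (exists_tameFourier (lcSpatialFlip_single (d := d))).choose

theorem tameSpatialFourier_apply (g : tameSchwartz d) {p : Space (d + 1)} (hp : p 0 ≠ 0) :
    tameSpatialFourier d g p = (lcSpatialFourier d).symm (g : 𝓢(Space (d + 1), ℂ)) p :=
  (exists_tameFourier lcSpatialFlip_single).choose_spec g p hp

/-- `𝓕_L⁻¹` as a map from the tame test functions to the squeezed Schwartz space. -/
def tameFourier (d : ℕ) : tameSchwartz (d + 1) →L[ℂ] SqueezedSchwartz (d + 1) :=
  (exists_tameFourier (lcFlip_single (d := d))).choose

theorem tameFourier_apply (g : tameSchwartz (d + 1)) {p : Space (d + 2)} (hp : p 0 ≠ 0) :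
    tameFourier d g p = (lcFourier d).symm (g : 𝓢(Space (d + 2), ℂ)) p :=
  (exists_tameFourier lcFlip_single).choose_spec g p hp

/-! ### Parameter families -/

/-- Testing against all f determines (U_t, g) for almost every t, and continuity in t removes the
exceptional set. -/
theorem IsParameterFamily.unique {v : TameDual (d + 1)} {U U' : ℝ → TameDual d}
    (hU : IsParameterFamily ⊤ v U) (hU' : IsParameterFamily ⊤ v U') : U = U' := by
  funext t
  ext g
  have hc : ∀ {U : ℝ → TameDual d}, IsParameterFamily ⊤ v U → Continuous fun t => U t g := by
    intro U hU
    have := (hU.1 g).continuousOn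
    rwa [Opens.coe_top, continuousOn_univ] at this
  have hae : ∀ᵐ t : ℝ, U t g - U' t g = 0 := by
    refine ae_eq_zero_of_integral_contDiff_smul_eq_zero
      (((hc hU).sub (hc hU')).locallyIntegrable) fun f hf hfc => ?_
    let F : 𝓓((⊤ : Opens ℝ), ℂ) :=
      ⟨fun t => (f t : ℂ), Complex.ofRealCLM.contDiff.comp hf,
        hfc.comp_left (g := fun s : ℝ => (s : ℂ)) Complex.ofReal_zero, fun _ _ => trivial⟩
    have hF : ∀ t, F t = f t := fun t => rfl
    have hFc : HasCompactSupport F := F.hasCompactSupport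
    obtain ⟨φ, hφ, h1⟩ := hU.2 F g
    obtain ⟨φ', hφ', h2⟩ := hU'.2 F g
    have e : φ = φ' := Subtype.ext (SchwartzMap.ext fun x => (hφ x).trans (hφ' x).symm)
    rw [e, h2, Opens.coe_top, setIntegral_univ, setIntegral_univ] at h1
    have i1 : Integrable fun t => U t g * F t :=
      ((hc hU).mul F.continuous).integrable_of_hasCompactSupport hFc.mul_left
    have i2 : Integrable fun t => U' t g * F t :=
      ((hc hU').mul F.continuous).integrable_of_hasCompactSupport hFc.mul_left
    rw [← sub_eq_zero.2 h1.symm, ← integral_sub i1 i2]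
    refine integral_congr_ae (Filter.Eventually.of_forall fun t => ?_)
    simp only [hF, Complex.real_smul]
    ring
  have := ((hc hU).sub (hc hU')).ae_eq_iff_eq volume continuous_const |>.1 hae
  exact sub_eq_zero.1 (congrFun this t)

end LightCone

end

noncomputable section

namespace LightCone

variable {d k : ℕ}

/-! ### The mass shell distribution -/

theorem isMultiplier_inv_two_mul_abs :
    IsMultiplier (fun p : Space (k + 1) => (1 / ((2 * |p 0| : ℝ) : ℂ))) := by
  refine ((IsMultiplier.const (1 / 2 : ℂ)).mul IsMultiplier.abs_inv_coord.ofReal).congr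
    fun p _ => ?_
  push_cast
  rw [one_div, one_div, mul_inv]

/-- The map `f ↦ f(Ω̃(p)) / (2|p⁺|)`. -/
def shellCLM {m : ℝ} (hm : 0 < m) : 𝓢(Space (d + 2), ℂ) →L[ℂ] SqueezedSchwartz d :=
  isMultiplier_inv_two_mul_abs.mulCLM.comp (exists_comp_shellPoint hm).choose

theorem shellCLM_apply {m : ℝ} (hm : 0 < m) (f : 𝓢(Space (d + 2), ℂ)) {p : Space (d + 1)}
    (hp : p 0 ≠ 0) : shellCLM hm f p = f (shellPoint m p) / ((2 * |p 0| : ℝ) : ℂ) := by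
  rw [shellCLM, ContinuousLinearMap.comp_apply, IsMultiplier.mulCLM_apply _ _ hp,
    (exists_comp_shellPoint hm).choose_spec f p hp]
  ring

/-- The distribution `b(p) δ(p̃² - m²)`. -/
def shellDelta {m : ℝ} (hm : 0 < m) (b : SqueezedDual d) : 𝓢'(Space (d + 2), ℂ) :=
  ContinuousLinearMap.toPointwiseConvergenceCLM _ _ _ _ (b.comp (shellCLM hm))

theorem isShellDelta_shellDelta {m : ℝ} (hm : 0 < m) (b : SqueezedDual d) :
    IsShellDelta m b (shellDelta hm b) := fun f =>
  ⟨shellCLM hm f, fun _ hp => shellCLM_apply hm f hp, rfl⟩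

theorem IsShellDelta.unique {m : ℝ} {b : SqueezedDual d} {v v' : 𝓢'(Space (d + 2), ℂ)}
    (hv : IsShellDelta m b v) (hv' : IsShellDelta m b v') : v = v' := by
  ext f
  exact (hv f).unique (hv' f)

/-- A test function as a Schwartz function. -/
theorem exists_schwartz_eq (f : 𝓓((⊤ : Opens ℝ), ℂ)) : ∃ F : 𝓢(ℝ, ℂ), ∀ t, F t = f t :=
  ⟨f.hasCompactSupport.toSchwartzMap f.contDiff, fun _ => rfl⟩

/-- The functional `(e^{-iω̃t} / |p⁺|) b`. -/
def evolvedDual (m : ℝ) (b : SqueezedDual d) (t : ℝ) : SqueezedDual d :=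
  b.comp (IsMultiplier.abs_inv_coord.ofReal.mulCLM.comp ((isMultiplier_lcEnergy m).expCLM t))

theorem isMul_evolvedDual (m : ℝ) (b : SqueezedDual d) (t : ℝ) :
    IsMul (fun p => Complex.exp (-Complex.I * (lcEnergy m p : ℂ) * (t : ℂ)) / ((|p 0| : ℝ) : ℂ))
      b (evolvedDual m b t) := by
  refine fun f => ⟨IsMultiplier.abs_inv_coord.ofReal.mulCLM
    ((isMultiplier_lcEnergy m).expCLM t f), fun p hp => ?_, rfl⟩
  rw [IsMultiplier.mulCLM_apply _ _ hp, IsMultiplier.expCLM_apply _ _ _ hp]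
  push_cast
  ring

theorem isParameterFamily_shellDelta {m : ℝ} (hm : 0 < m) (b : SqueezedDual d) :
    IsParameterFamily ⊤ (relaxation (lcFourierInv (shellDelta hm b)))
      (fun t => (1 / (4 * (Real.pi : ℂ))) • (evolvedDual m b t).comp (tameSpatialFourier d)) := by
  set hω := isMultiplier_lcEnergy (d := d) m
  set T : SqueezedDual d := (1 / (4 * (Real.pi : ℂ))) •
    b.comp IsMultiplier.abs_inv_coord.ofReal.mulCLM with hT
  have hU : ∀ (t : ℝ) (g : tameSchwartz d), ((1 / (4 * (Real.pi : ℂ))) •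
      (evolvedDual m b t).comp (tameSpatialFourier d)) g
      = T (hω.expCLM t (tameSpatialFourier d g)) := fun t g => rfl
  refine ⟨fun g => ?_, fun f g => ?_⟩
  · simp only [hU]
    exact (hω.contDiff_expCLM T _).contDiffOn
  · obtain ⟨F, hF⟩ := exists_schwartz_eq f
    obtain ⟨φ, hφ⟩ := exists_tame_tensor F g
    refine ⟨φ, fun x => by rw [hφ, hF], ?_⟩
    rw [Opens.coe_top, setIntegral_univ]
    set h := tameSpatialFourier d g with hh
    -- The constant 1/(4π) is the 1/2 from 1/(2|p⁺|) times the 1/(2π) from the transform in x⁺.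
    set G := (1 / (4 * (Real.pi : ℂ))) • IsMultiplier.abs_inv_coord.ofReal.mulCLM h with hG
    have key := hω.integral_expCLM b G
      (shellCLM hm ((lcFourier d).symm (φ : 𝓢(Space (d + 2), ℂ)))) f.continuous
      f.hasCompactSupport fun p hp => by
        rw [shellCLM_apply hm _ hp, lcFourier_symm_tensor F _ _ hφ, momentum_shellPoint,
          shellPoint_last, hG, SqueezedSchwartz.smul_apply, IsMultiplier.mulCLM_apply _ _ hp, hh,
          tameSpatialFourier_apply g hp]
        simp only [hF]
        have h1 : (Real.pi : ℂ) ≠ 0 := by exact_mod_cast Real.pi_ne_zero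
        have h2 : ((|p 0| : ℝ) : ℂ) ≠ 0 := Complex.ofReal_ne_zero.2 (abs_ne_zero.2 hp)
        push_cast
        field_simp
        ring
    refine Eq.trans key (integral_congr_ae (Filter.Eventually.of_forall fun t => ?_))
    simp only [hU]
    rw [mul_comm]
    congr 1
    have : hω.expCLM t G = (1 / (4 * (Real.pi : ℂ))) •
        IsMultiplier.abs_inv_coord.ofReal.mulCLM (hω.expCLM t h) := by
      refine SqueezedSchwartz.ext_off fun p hp => ?_
      rw [hG, map_smul, SqueezedSchwartz.smul_apply, SqueezedSchwartz.smul_apply,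
        IsMultiplier.mulCLM_apply _ _ hp, IsMultiplier.expCLM_apply _ _ _ hp,
        IsMultiplier.expCLM_apply _ _ _ hp, IsMultiplier.mulCLM_apply _ _ hp]
      ring
    rw [this, map_smul]
    rfl

theorem isSpatialFourierInv_comp (c : SqueezedDual d) :
    IsSpatialFourierInv c (c.comp (tameSpatialFourier d)) := fun g =>
  ⟨tameSpatialFourier d g, fun _ hp => tameSpatialFourier_apply g hp, rfl⟩

/-! ### Solutions of the Klein-Gordon equation -/

theorem lcFlip_single_zero :
    lcFlip d (EuclideanSpace.single 0 1) = EuclideanSpace.single (Fin.last (d + 1)) 1 := by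
  rw [← lcFlip_single]
  exact (lcFlip d).left_inv _

theorem lcFlip_single_perp (i : Fin d) : lcFlip d (EuclideanSpace.single i.succ.castSucc 1) =
    -EuclideanSpace.single i.succ.castSucc 1 := by
  ext j
  refine Fin.cases ?_ (fun j => ?_) j
  · simp [lcFlip, Fin.ext_iff]
    omega
  · refine Fin.lastCases ?_ (fun l => ?_) j
    · simp [lcFlip, Fin.ext_iff]
      omega
    · simp [lcFlip, Fin.ext_iff]

theorem lineDerivOp_lineDerivOp_lcFourier (v w : Space (d + 2)) (S : 𝓢(Space (d + 2), ℂ)) :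
    ∃ R : 𝓢(Space (d + 2), ℂ), ∂_{w} (∂_{v} (lcFourier d S)) = lcFourier d R ∧
      ∀ p, R p = -(((inner ℝ p (lcFlip d v) * inner ℝ p (lcFlip d w) : ℝ) : ℂ) * S p) := by
  have ht : ∀ v : Space (d + 2), (fun p : Space (d + 2) => inner ℝ p v).HasTemperateGrowth := by
    intro v; fun_prop
  rw [lcFourier, lineDerivOp_fourierVia, lineDerivOp_fourierVia]
  refine ⟨_, rfl, fun p => ?_⟩
  rw [smul_apply, SchwartzMap.smulLeftCLM_apply_apply (ht _), smul_apply,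
    SchwartzMap.smulLeftCLM_apply_apply (ht _)]
  simp only [Complex.real_smul, smul_eq_mul]
  push_cast
  linear_combination ((inner ℝ p (lcFlip d w) : ℝ) : ℂ) * ((inner ℝ p (lcFlip d v) : ℝ) : ℂ) *
    S p * Complex.I_mul_I

theorem schwartzMap_ext_off {f g : 𝓢(Space (k + 1), ℂ)} (h : ∀ p, p 0 ≠ 0 → f p = g p) :
    f = g :=
  DFunLike.coe_injective (Continuous.ext_on (dense_offPlane k) f.continuous g.continuous h)

/-- The Klein-Gordon operator transforms to minus multiplication by p̃² - m². Being of even order in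
each term, it moves onto the test function without a sign, apart from the mass term, which has none.
-/
theorem SolvesLCKG.apply_lcFourier {m : ℝ} {u : 𝓢'(Space (d + 2), ℂ)} (hu : SolvesLCKG m u)
    {S R : 𝓢(Space (d + 2), ℂ)} (hR : ∀ p, p 0 ≠ 0 → R p =
      ((2 * p (Fin.last (d + 1)) * p 0 - ∑ i : Fin d, p i.succ.castSucc ^ 2 - m ^ 2 : ℝ) : ℂ) *
        S p) : u (lcFourier d R) = 0 := by
  have h := DFunLike.congr_fun hu (lcFourier d S)
  obtain ⟨A, hA, hA'⟩ := lineDerivOp_lineDerivOp_lcFourier (EuclideanSpace.single 0 1)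
    (EuclideanSpace.single (Fin.last (d + 1)) 1) S
  choose B hB hB' using fun i : Fin d => lineDerivOp_lineDerivOp_lcFourier
    (EuclideanSpace.single i.succ.castSucc 1) (EuclideanSpace.single i.succ.castSucc 1) S
  have e : R = -((2 : ℂ) • A - ∑ i, B i + ((m ^ 2 : ℝ) : ℂ) • S) := by
    refine schwartzMap_ext_off fun p hp => ?_
    rw [hR p hp, neg_apply, add_apply, sub_apply, smul_apply, smul_apply, sum_apply, hA',
      lcFlip_single, lcFlip_single_zero]
    simp only [hB', lcFlip_single_perp, inner_neg_right, EuclideanSpace.inner_single_right]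
    simp only [smul_eq_mul, Finset.sum_neg_distrib, ← Finset.sum_mul]
    push_cast
    simp only [one_mul, ← pow_two, conj_trivial, neg_sq]
    ring
  have h2 : u ((2 : ℂ) • lcFourier d A - ∑ i, lcFourier d (B i) +
      ((m ^ 2 : ℝ) : ℂ) • lcFourier d S) = 0 := by
    rw [← hA]
    simp only [← hB]
    rw [map_add, map_sub, map_smul, map_smul, map_sum]
    refine Eq.trans ?_ h
    rw [add_apply, sub_apply, smul_apply, smul_apply, sum_apply]
    simp only [TemperedDistribution.lineDerivOp_apply_apply, map_neg, neg_neg]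
  rw [e, map_neg, map_neg, map_add, map_sub, map_smul, map_smul, map_sum, h2, neg_zero]

end LightCone

end

noncomputable section

namespace LightCone

variable {d k : ℕ}

/-! ### Invariance of the transformed solution -/

/-- The inclusion of the squeezed Schwartz space into the Schwartz space. -/
def toSchwartzCLM (k : ℕ) : SqueezedSchwartz k →L[ℂ] 𝓢(Space (k + 1), ℂ) :=
  SqueezedSchwartz.exists_toSchwartz.choose

theorem toSchwartzCLM_apply (f : SqueezedSchwartz k) (p : Space (k + 1)) :
    toSchwartzCLM k f p = f p := SqueezedSchwartz.exists_toSchwartz.choose_spec f p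

/-- The Fourier transform of a tempered distribution, as a squeezed generalized function of all
the momentum variables. -/
def fourierSqueezed (u : 𝓢'(Space (d + 2), ℂ)) : SqueezedDual (d + 1) :=
  (⟨u.toLinearMap, u.cont⟩ : 𝓢(Space (d + 2), ℂ) →L[ℂ] ℂ).comp
    ((lcFourier d : 𝓢(Space (d + 2), ℂ) →L[ℂ] 𝓢(Space (d + 2), ℂ)).comp (toSchwartzCLM (d + 1)))

theorem fourierSqueezed_apply (u : 𝓢'(Space (d + 2), ℂ)) (F : SqueezedSchwartz (d + 1)) :
    fourierSqueezed u F = u (lcFourier d (toSchwartzCLM (d + 1) F)) := rfl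

theorem fourierSqueezed_tameFourier (u : 𝓢'(Space (d + 2), ℂ)) (φ : tameSchwartz (d + 1)) :
    fourierSqueezed u (tameFourier d φ) = relaxation u φ := by
  have : toSchwartzCLM (d + 1) (tameFourier d φ) =
      (lcFourier d).symm (φ : 𝓢(Space (d + 2), ℂ)) :=
    schwartzMap_ext_off fun p hp => by rw [toSchwartzCLM_apply, tameFourier_apply φ hp]
  rw [fourierSqueezed_apply, this, ContinuousLinearEquiv.apply_symm_apply]
  rfl

/-- The deviation `p⁻ - ω̃(p⁺, p_⊥)` from the mass shell. -/
def shellDeviation (m : ℝ) (p : Space (d + 2)) : ℝ :=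
  p (Fin.last (d + 1)) - lcEnergy m (momentum p)

theorem isMultiplier_shellDeviation (m : ℝ) :
    IsMultiplier (shellDeviation m : Space (d + 2) → ℝ) :=
  ((IsMultiplier.coord (Fin.last (d + 1))).add ((IsMultiplier.const (-1 : ℝ)).mul
    (isMultiplier_lcEnergy_momentum m))).congr fun p _ => by rw [shellDeviation]; ring

/-- From p̃² - m² = 2p⁺(p⁻ - ω̃): the factor 2p⁺ can be divided out because 1/p⁺ is a multiplier. -/
theorem SolvesLCKG.fourierSqueezed_mul {m : ℝ} {u : 𝓢'(Space (d + 2), ℂ)} (hu : SolvesLCKG m u)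
    (F : SqueezedSchwartz (d + 1)) :
    fourierSqueezed u ((isMultiplier_shellDeviation m).ofReal.mulCLM F) = 0 := by
  have hinv : IsMultiplier (fun p : Space (d + 2) => ((2⁻¹ * (p 0)⁻¹ : ℝ) : ℂ)) :=
    ((IsMultiplier.const (2⁻¹ : ℝ)).mul IsMultiplier.inv_coord).ofReal
  rw [fourierSqueezed_apply]
  refine hu.apply_lcFourier (S := toSchwartzCLM (d + 1) (hinv.mulCLM F)) fun p hp => ?_
  rw [toSchwartzCLM_apply, toSchwartzCLM_apply, IsMultiplier.mulCLM_apply _ _ hp,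
    IsMultiplier.mulCLM_apply _ _ hp, ← mul_assoc, ← Complex.ofReal_mul]
  congr 2
  have h1 : ‖perp (momentum p)‖ ^ 2 = ∑ i : Fin d, p i.succ.castSucc ^ 2 := by
    rw [EuclideanSpace.real_norm_sq_eq]
    rfl
  rw [shellDeviation, lcEnergy, h1, momentum_zero]
  field_simp
  ring

/-- The t-derivative contains the factor p⁻ - ω̃, which the transform of u annihilates. -/
theorem SolvesLCKG.fourierSqueezed_expCLM {m : ℝ} {u : 𝓢'(Space (d + 2), ℂ)}
    (hu : SolvesLCKG m u) (F : SqueezedSchwartz (d + 1)) (t : ℝ) :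
    fourierSqueezed u ((isMultiplier_shellDeviation m).expCLM t F) = fourierSqueezed u F := by
  set hl := isMultiplier_shellDeviation (d := d) m
  have hd : ∀ t, HasDerivAt (fun t => fourierSqueezed u (hl.expCLM t F)) 0 t := by
    intro t
    refine (hl.hasDerivAt_expCLM (fourierSqueezed u) F t).congr_deriv ?_
    have : hl.expCLM t (hl.ofReal.mulCLM F) = hl.ofReal.mulCLM (hl.expCLM t F) :=
      SqueezedSchwartz.ext_off fun p hp => by
        rw [hl.expCLM_apply _ _ hp, hl.ofReal.mulCLM_apply _ hp, hl.ofReal.mulCLM_apply _ hp,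
          hl.expCLM_apply _ _ hp]
        ring
    rw [this, hu.fourierSqueezed_mul, mul_zero]
  have h0 : hl.expCLM 0 F = F := SqueezedSchwartz.ext_off fun p hp => by
    rw [hl.expCLM_apply _ _ hp]; simp
  have := is_const_of_deriv_eq_zero (fun t => (hd t).differentiableAt) (fun t => (hd t).deriv) t 0
  simpa only [h0] using this

/-! ### Spreading around the mass shell -/

theorem exists_weight_le_shellDeviation (m : ℝ) : ∃ (K : ℕ) (C : ℝ), 0 ≤ C ∧
    ∀ p ∈ offPlane (d + 1), weight p ≤
      C * (1 + |shellDeviation m p|) * weight (momentum p) ^ K := by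
  obtain ⟨M, D, hD, h0, -⟩ := (isMultiplier_lcEnergy (d := d) m).uniform_pow 0
  refine ⟨M + 1, 3 + D, by linarith, fun p hp => ?_⟩
  have h1 : |lcEnergy m (momentum p)| ≤ D * weight (momentum p) ^ M := h0 (momentum p) hp
  set w := weight (momentum p) with hw
  have hw1 : 1 ≤ w := one_le_weight _
  -- For a full momentum, `perp p` contains p⁻ as well as p_⊥; p⁻ is the deviation plus ω̃, and ω̃
  -- is controlled by the spatial weight.
  have h2 : ‖perp p‖ ≤ |shellDeviation m p| + |lcEnergy m (momentum p)| + w := by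
    have a1 := (norm_perp_le p).trans (norm_le_abs_add_norm_momentum p)
    have a2 : ‖momentum p‖ ≤ w := by linarith [one_add_norm_le_weight (momentum p)]
    have a3 : |p (Fin.last (d + 1))| ≤ |shellDeviation m p| + |lcEnergy m (momentum p)| := by
      refine le_trans (le_of_eq ?_) (abs_add_le _ _)
      rw [shellDeviation, sub_add_cancel]
    linarith
  have h3 : 1 + |p 0| + |p 0|⁻¹ ≤ w := by
    rw [hw, weight, momentum_zero]
    linarith [norm_nonneg (perp (momentum p))]
  have h4 : w ^ M ≤ w ^ (M + 1) := pow_le_pow_right₀ hw1 (Nat.le_succ M)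
  have h5 : w ≤ w ^ (M + 1) := le_self_pow₀ hw1 (Nat.succ_ne_zero M)
  have h6 : |lcEnergy m (momentum p)| ≤ D * w ^ (M + 1) :=
    h1.trans (mul_le_mul_of_nonneg_left h4 (by linarith))
  have h7 := abs_nonneg (shellDeviation m p)
  have h8 : weight p ≤ (3 + D) * w ^ (M + 1) + |shellDeviation m p| := by
    rw [weight]; linarith
  have h9 : |shellDeviation m p| * 1 ≤ |shellDeviation m p| * ((3 + D) * w ^ (M + 1)) := by
    refine mul_le_mul_of_nonneg_left ?_ h7
    exact one_le_mul_of_one_le_of_one_le (by linarith) (hw1.trans h5)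
  calc weight p ≤ (3 + D) * w ^ (M + 1) + |shellDeviation m p| * 1 := by rwa [mul_one]
    _ ≤ (3 + D) * w ^ (M + 1) + |shellDeviation m p| * ((3 + D) * w ^ (M + 1)) := by gcongr
    _ = _ := by ring

/-- The map `h ↦ χ(p⁻ - ω̃(p)) h(p)`, which spreads a function of the spatial momentum around the
mass shell. -/
theorem exists_spread (m : ℝ) (χ : 𝓢(ℝ, ℂ)) :
    ∃ A : SqueezedSchwartz d →L[ℂ] SqueezedSchwartz (d + 1), ∀ h p, p 0 ≠ 0 →
      A h p = χ (shellDeviation m p) * h (momentum p) := by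
  have hl := isMultiplier_shellDeviation (d := d) m
  have hχ : ContDiffOn ℝ ∞ (fun p : Space (d + 2) => χ (shellDeviation m p)) (offPlane (d + 1)) :=
    (χ.smooth ⊤).comp_contDiffOn hl.1
  have hmom : ∀ h : SqueezedSchwartz d,
      ContDiff ℝ ∞ (fun p : Space (d + 2) => h (momentum p)) := fun h =>
    h.2.1.comp (momentumCLM d).contDiff
  refine SqueezedSchwartz.exists_clm (V := SqueezedSchwartz d)
    (fun h p => χ (shellDeviation m p) * h (momentum p))
    (fun f g p _ => by rw [SqueezedSchwartz.add_apply]; ring)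
    (fun c f p _ => by rw [SqueezedSchwartz.smul_apply]; ring)
    (fun h => hχ.mul (hmom h).contDiffOn) fun N n => ?_
  obtain ⟨M, D, hD, -, hlb⟩ := hl.uniform_pow n
  obtain ⟨L, C, hC, hw⟩ := exists_weight_le_shellDeviation (d := d) m
  -- Decay of χ controls the deviation and decay of h the spatial weight; together they beat K
  -- powers of the full weight.
  set K := N + M * n with hK
  obtain ⟨q, hq, hq'⟩ := SqueezedSchwartz.exists_seminorm (k := d) (L * K) n
  set A := 2 ^ K * (Finset.Iic (K, n)).sup (fun m => SchwartzMap.seminorm ℝ m.1 m.2) χ with hA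
  have hA0 : 0 ≤ A := by positivity
  refine ⟨Real.toNNReal (2 ^ n * (n.factorial * A * D ^ n) * C ^ K) • q, hq.const_smul _,
    fun h p hp => ?_⟩
  have hs : 0 < 1 + |shellDeviation m p| := by positivity
  have hwp := weight_pos p
  have hwm := weight_pos (momentum p)
  have hqh : 0 ≤ q h := apply_nonneg q h
  have h1 : ∀ i ≤ n, ‖iteratedFDeriv ℝ i (fun p => χ (shellDeviation m p)) p‖ ≤
      n.factorial * (A / (1 + |shellDeviation m p|) ^ K) * (D * weight p ^ M) ^ n := by
    intro i hi
    have hDw : 1 ≤ D * weight p ^ M :=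
      one_le_mul_of_one_le_of_one_le hD (one_le_pow₀ (one_le_weight p))
    refine (norm_iteratedFDeriv_comp_le_of_isOpen (isOpen_offPlane (d + 1)) isOpen_univ
      (χ.smooth ⊤).contDiffOn hl.1 (Set.mapsTo_univ _ _) hp (n := i)
      (C := A / (1 + |shellDeviation m p|) ^ K) (fun j hj => ?_)
      (fun j h1 hj => hlb p hp j h1 (hj.trans hi))).trans ?_
    · rw [le_div_iff₀' (by positivity)]
      exact SchwartzMap.one_add_le_sup_seminorm_apply (𝕜 := ℝ) (m := (K, n)) le_rfl
        (hj.trans hi) χ _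
    · gcongr
  have h2 : ∀ i ≤ n, ‖iteratedFDeriv ℝ i (fun p => h (momentum p)) p‖ ≤
      q h / weight (momentum p) ^ (L * K) := by
    intro i hi
    rw [le_div_iff₀' (by positivity)]
    refine le_trans ?_ (hq' h i hi (momentum p) hp)
    exact mul_le_mul_of_nonneg_left
      (norm_iteratedFDeriv_comp_clm_le h.2.1 (momentumCLM d) norm_momentumCLM_le i p)
      (by positivity)
  have h3 := norm_iteratedFDeriv_mul_le_two_pow (isOpen_offPlane (d + 1)) hχ
    (hmom h).contDiffOn hp (n := n) h1 h2
  have h4 : weight p ^ K ≤ C ^ K * (1 + |shellDeviation m p|) ^ K *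
      weight (momentum p) ^ (L * K) := by
    rw [pow_mul, ← mul_pow, ← mul_pow]
    exact pow_le_pow_left₀ hwp.le (hw p hp) K
  set s := (1 + |shellDeviation m p|) ^ K with hsdef
  set r := weight (momentum p) ^ (L * K) with hr
  have hs0 : 0 < s := by positivity
  have hr0 : 0 < r := by positivity
  calc _ ≤ weight p ^ N * (2 ^ n * (n.factorial * (A / s) * (D * weight p ^ M) ^ n) * (q h / r)) :=
        mul_le_mul_of_nonneg_left h3 (by positivity)
    _ = weight p ^ K * (2 ^ n * (n.factorial * (A / s) * D ^ n) * (q h / r)) := by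
        rw [hK, pow_add, pow_mul, mul_pow]; ring
    _ ≤ C ^ K * s * r * (2 ^ n * (n.factorial * (A / s) * D ^ n) * (q h / r)) := by gcongr
    _ = (2 ^ n * (n.factorial * A * D ^ n) * C ^ K) * q h := by field_simp
    _ = _ := by
        change _ = (Real.toNNReal (2 ^ n * (n.factorial * A * D ^ n) * C ^ K) : ℝ) * q h
        rw [Real.coe_toNNReal _ (by positivity)]

theorem exists_mollifier : ∃ η : 𝓢(ℝ, ℂ), HasCompactSupport η ∧ ∫ t, η t = 1 := by
  let f : ContDiffBump (0 : ℝ) := ⟨1, 2, one_pos, one_lt_two⟩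
  have hc : HasCompactSupport fun t : ℝ => (f.normed volume t : ℂ) :=
    f.hasCompactSupport_normed.comp_left (g := fun s : ℝ => (s : ℂ)) Complex.ofReal_zero
  have hs : ContDiff ℝ ∞ fun t : ℝ => (f.normed volume t : ℂ) :=
    Complex.ofRealCLM.contDiff.comp f.contDiff_normed
  refine ⟨hc.toSchwartzMap hs, hc, ?_⟩
  change ∫ t, (f.normed volume t : ℂ) = 1
  rw [integral_complex_ofReal, f.integral_normed, Complex.ofReal_one]

/-- As a function of all momenta, ĝ alone has no decay in p⁻. Inserting χ(p⁻ - ω̃), which T does not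
notice, supplies it and lets the integral over t leave T. -/
theorem SolvesLCKG.dependsSmoothly {m : ℝ} {u : 𝓢'(Space (d + 2), ℂ)} (hu : SolvesLCKG m u) :
    DependsSmoothly ⊤ (relaxation u) := by
  obtain ⟨η, hηc, hη⟩ := exists_mollifier
  obtain ⟨χ, hχ, -⟩ := exists_schwartz_fourier η
  obtain ⟨A, hA⟩ := exists_spread (d := d) m χ
  have hl := isMultiplier_shellDeviation (d := d) m
  have hω := isMultiplier_lcEnergy_momentum (d := d) m
  have hlast : IsMultiplier (fun p : Space (d + 2) => p (Fin.last (d + 1))) := .coord _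
  set T := fourierSqueezed u with hT
  set B : tameSchwartz d →L[ℂ] SqueezedSchwartz (d + 1) :=
    (1 / (2 * Real.pi) : ℂ) • A.comp (tameSpatialFourier d) with hB
  refine ⟨fun t => (T.comp (hω.expCLM t)).comp B, fun g => ?_, fun f g => ?_⟩
  · exact (hω.contDiff_expCLM T (B g)).contDiffOn
  · obtain ⟨F, hF⟩ := exists_schwartz_eq f
    obtain ⟨φ, hφ⟩ := exists_tame_tensor F g
    refine ⟨φ, fun x => by rw [hφ, hF], ?_⟩
    rw [Opens.coe_top, setIntegral_univ, ← fourierSqueezed_tameFourier]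
    set G := tameFourier d φ with hG
    set H := (hl.comp χ.hasTemperateGrowth).mulCLM G with hH
    -- Averaging the invariance of T against η, whose integral is 1, shows that the cutoff leaves T
    -- unchanged.
    have h1 : T H = T G := by
      rw [hl.integral_expCLM T G H η.continuous hηc fun p hp => by
        rw [hH, IsMultiplier.mulCLM_apply _ _ hp, hχ]]
      simp only [hT, hu.fourierSqueezed_expCLM]
      rw [integral_mul_const, hη, one_mul]
    rw [← h1, hlast.integral_expCLM T (B g) H f.continuous f.hasCompactSupport fun p hp => by
      have e : B g p = (1 / (2 * Real.pi) : ℂ) * A (tameSpatialFourier d g) p := rfl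
      rw [hH, IsMultiplier.mulCLM_apply _ _ hp, hG, tameFourier_apply φ hp,
        lcFourier_symm_tensor F _ _ hφ, e, hA _ p hp,
        tameSpatialFourier_apply g (p := momentum p) hp]
      simp only [hF]
      ring]
    refine integral_congr_ae (Filter.Eventually.of_forall fun t => ?_)
    -- Since p⁻ = (p⁻ - ω̃) + ω̃, invariance of T replaces e^{-ip⁻t} by e^{-iω̃t}.
    have h2 : hlast.expCLM t (B g) = hl.expCLM t (hω.expCLM t (B g)) := by
      refine SqueezedSchwartz.ext_off fun p hp => ?_
      rw [hl.expCLM_apply _ _ hp, hω.expCLM_apply _ _ hp, hlast.expCLM_apply _ _ hp, ← mul_assoc,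
        ← Complex.exp_add, shellDeviation]
      congr 2
      push_cast
      ring
    simp only
    rw [h2, mul_comm]
    congr 1
    exact hu.fourierSqueezed_expCLM _ t

end LightCone

end

theorem mainTheorem2 (d : ℕ) (m : ℝ) (hm : 0 < m) :
    (∀ b : LightCone.SqueezedDual d,
      ∃ v : TemperedDistribution (LightCone.Space (d + 2)) ℂ,
        LightCone.IsShellDelta m b v ∧
        (∀ v' : TemperedDistribution (LightCone.Space (d + 2)) ℂ,
          LightCone.IsShellDelta m b v' → v' = v) ∧
        LightCone.DependsSmoothly ⊤ (LightCone.relaxation (LightCone.lcFourierInv v)) ∧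
        ∀ U : ℝ → LightCone.TameDual d,
          LightCone.IsParameterFamily ⊤ (LightCone.relaxation (LightCone.lcFourierInv v)) U →
          ∀ t : ℝ, ∃ (c : LightCone.SqueezedDual d) (w : LightCone.TameDual d),
            LightCone.IsMul
              (fun p => Complex.exp (-Complex.I * (LightCone.lcEnergy m p : ℂ) * (t : ℂ))
                / ((|p 0| : ℝ) : ℂ)) b c ∧
            LightCone.IsSpatialFourierInv c w ∧
            U t = (1 / (4 * (Real.pi : ℂ))) • w) ∧
    (∀ u : TemperedDistribution (LightCone.Space (d + 2)) ℂ,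
      LightCone.SolvesLCKG m u → LightCone.AdmitsTameRestriction u) := by
  refine ⟨fun b => ⟨LightCone.shellDelta hm b, LightCone.isShellDelta_shellDelta hm b,
    fun v' hv' => hv'.unique (LightCone.isShellDelta_shellDelta hm b),
    ⟨_, LightCone.isParameterFamily_shellDelta hm b⟩, fun U hU t => ?_⟩,
    fun u hu => ⟨⊤, trivial, hu.dependsSmoothly⟩⟩
  -- Uniqueness identifies an arbitrary family U with the one constructed explicitly.
  exact ⟨LightCone.evolvedDual m b t, _, LightCone.isMul_evolvedDual m b t,
    LightCone.isSpatialFourierInv_comp _,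
    congrFun (hU.unique (LightCone.isParameterFamily_shellDelta hm b)) t⟩
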